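/- Let $T>0$. Let $\widehat H^0(\mathbb R^2)$ be the closed subspace of the complex space $L^2(\mathbb R^2)$ that consists of the functions even with respect to $x_1$, and let $\widehat H^{-2}(\mathbb R^2)$ be the subspace of the distributions even with respect to $x_1$ in $H^{-2}(\mathbb R^2)=(H^2(\mathbb R^2))^*$. For $W^0\in\widehat H^0(\mathbb R^2)$ and a control $u\in L^\infty(0,T)$ consider the system $$W_t=\Delta W-2\,\delta\,u(t),\quad t\in(0,T),\qquad W(\cdot,0)=W^0,$$ where $\delta$ is the Dirac distribution at $0\in\mathbb R^2$. A solution is a function $W:[0,T]\to\widehat H^0(\mathbb R^2)$ with $W(\cdot,0)=W^0$ that is absolutely continuous on $[0,T]$ as a function with values in $H^{-2}(\mathbb R^2)$ and that, for almost all $t\in(0,T)$, has a derivative $W_t$ (with respect to the norm of $H^{-2}(\mathbb R^2)$) which belongs to $\widehat H^{-2}(\mathbb R^2)$ and equals $\Delta W(\cdot,t)-2u(t)\delta$. Let $\mathcal R_T(W^0)$ be the set of all $V\in\widehat H^0(\mathbb R^2)$ for which there is a control $u\in L^\infty(0,T)$ such that the system has a unique solution $W$ and $W(\cdot,T)=V$.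 A state $W^0$ is called approximately controllable to $W^T\in\widehat H^0(\mathbb R^2)$ in time $T$ if $W^T\in\overline{\mathcal R_T(W^0)}$, where the closure is taken in $\widehat H^0(\mathbb R^2)$. Let $$\mathcal H=\{f\in L^2(\mathbb R^2)\mid \exists g\in L^2(0,+\infty)\quad f(x)=g(|x|^2)\ \text{for almost all }x\in\mathbb R^2\},$$ $$W^T_0(x)=W^T(x)-\frac1{4\pi T}\int_{\mathbb R^2}e^{-\frac{|x-y|^2}{4T}}\,W^0(y)\,dy .$$ Theorem. For all $W^0,W^T\in\widehat H^0(\mathbb R^2)$, the state $W^0$ is approximately controllable to the state $W^T$ in time $T$ if and only if $W^T_0\in\mathcal H$. This holds for complex-valued states and controls; moreover, if $W^0$ and $W^T$ are real-valued, the same equivalence holds with approximate controllability by real-valued controls $u\in L^\infty(0,T)$. -/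

import Mathlib

noncomputable section

namespace HeatControl

open MeasureTheory Set Filter Topology
open scoped SchwartzMap LineDeriv Laplacian ENNReal Convolution

/-- The plane `ℝ²` with its Euclidean norm. The variables `x₁`, `x₂` are `x 0`, `x 1`. -/
abbrev Plane : Type := EuclideanSpace ℝ (Fin 2)

/-- The complex space `L²(ℝ²) = H⁰(ℝ²)`. -/
abbrev L2 : Type := Lp ℂ 2 (volume : Measure Plane)

/-! ### Distributions that are even with respect to `x₁` -/

/-- The reflection `(x₁, x₂) ↦ (-x₁, x₂)`. -/
def reflect : Plane ≃ₗᵢ[ℝ] Plane :=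
  LinearIsometryEquiv.piLpCongrRight 2
    (fun i : Fin 2 => if i = 0 then LinearIsometryEquiv.neg ℝ else LinearIsometryEquiv.refl ℝ ℝ)

theorem reflect_apply (x : Plane) : reflect x = !₂[-x 0, x 1] := by
  ext i
  fin_cases i <;> simp [reflect]

/-- The test function `(x₁, x₂) ↦ φ (-x₁, x₂)`. -/
def reflectTest : 𝓢(Plane, ℂ) →L[ℂ] 𝓢(Plane, ℂ) :=
  SchwartzMap.compCLMOfContinuousLinearEquiv ℂ reflect.toContinuousLinearEquiv

theorem reflectTest_apply (φ : 𝓢(Plane, ℂ)) (x : Plane) :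
    reflectTest φ x = φ !₂[-x 0, x 1] := by
  rw [← reflect_apply]
  rfl

/-- A tempered distribution on `ℝ²` is even with respect to `x₁`. -/
def IsEven (f : 𝓢'(Plane, ℂ)) : Prop :=
  ∀ φ : 𝓢(Plane, ℂ), f φ = f (reflectTest φ)

/-- The space `Ĥ⁰(ℝ²)` of the elements of `L²(ℝ²)` that are even with respect to `x₁`,
with the norm of `L²(ℝ²)`. -/
def EvenL2 : Submodule ℂ L2 where
  carrier := {f | IsEven (f : 𝓢'(Plane, ℂ))}
  add_mem' {f g} hf hg φ := by
    have h : ((f + g : L2) : 𝓢'(Plane, ℂ)) = (f : 𝓢'(Plane, ℂ)) + (g : 𝓢'(Plane, ℂ)) :=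
      map_add (Lp.toTemperedDistributionCLM ℂ volume 2) f g
    rw [h]
    exact congrArg₂ (· + ·) (hf φ) (hg φ)
  zero_mem' φ := by
    have h : ((0 : L2) : 𝓢'(Plane, ℂ)) = 0 := map_zero (Lp.toTemperedDistributionCLM ℂ volume 2)
    rw [h]
    rfl
  smul_mem' c f hf φ := by
    have h : ((c • f : L2) : 𝓢'(Plane, ℂ)) = c • (f : 𝓢'(Plane, ℂ)) :=
      map_smul (Lp.toTemperedDistributionCLM ℂ volume 2) c f
    rw [h]
    exact congrArg (c • ·) (hf φ)

/-! ### The spaces `H⁻ˢ(ℝ²)` -/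

/-- The partial derivative `∂₁^a ∂₂^b φ`, where `α = (a, b)`. -/
def partialDeriv (α : ℕ × ℕ) : 𝓢(Plane, ℂ) →L[ℂ] 𝓢(Plane, ℂ) :=
  LineDeriv.lineDerivOpCLM ℂ 𝓢(Plane, ℂ) (EuclideanSpace.single (0 : Fin 2) (1 : ℝ)) ^ α.1 *
    LineDeriv.lineDerivOpCLM ℂ 𝓢(Plane, ℂ) (EuclideanSpace.single (1 : Fin 2) (1 : ℝ)) ^ α.2

/-- The norm of `Hˢ(ℝ²)` on test functions:
`(∑_{|α| ≤ s} s! / ((s - |α|)! α!) ‖∂^α φ‖²)^{1/2}` with the norm of `L²(ℝ²)`. -/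
def sobolevNorm (s : ℕ) (φ : 𝓢(Plane, ℂ)) : ℝ :=
  √(∑ k ∈ Finset.range (s + 1), ∑ α ∈ Finset.HasAntidiagonal.antidiagonal k,
    ((s.factorial : ℝ) / ((s - k).factorial * α.1.factorial * α.2.factorial)) *
      ‖(partialDeriv α φ).toLp 2 (volume : Measure Plane)‖ ^ 2)

theorem sobolevNorm_nonneg (s : ℕ) (φ : 𝓢(Plane, ℂ)) : 0 ≤ sobolevNorm s φ :=
  Real.sqrt_nonneg _

theorem sobolevNorm_smul (s : ℕ) (c : ℂ) (φ : 𝓢(Plane, ℂ)) :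
    sobolevNorm s (c • φ) = ‖c‖ * sobolevNorm s φ := by
  have h (α : ℕ × ℕ) : ‖(partialDeriv α (c • φ)).toLp 2 (volume : Measure Plane)‖ =
      ‖c‖ * ‖(partialDeriv α φ).toLp 2 (volume : Measure Plane)‖ := by
    rw [map_smul]
    have := map_smul (SchwartzMap.toLpCLM ℂ ℂ 2 (volume : Measure Plane)) c (partialDeriv α φ)
    simp only [SchwartzMap.toLpCLM_apply] at this
    rw [this, norm_smul]
  rw [sobolevNorm, sobolevNorm, ← Real.sqrt_sq (norm_nonneg c), ← Real.sqrt_mul (sq_nonneg _)]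
  congr 1
  simp only [h, Finset.mul_sum]
  exact Finset.sum_congr rfl fun k _ => Finset.sum_congr rfl fun α _ => by ring

/-- The tempered distributions that are bounded with respect to the norm of `Hˢ(ℝ²)`. -/
def negSobolevSubmodule (s : ℕ) : Submodule ℂ 𝓢'(Plane, ℂ) where
  carrier := {f | ∃ C : ℝ, ∀ φ : 𝓢(Plane, ℂ), ‖f φ‖ ≤ C * sobolevNorm s φ}
  add_mem' := by
    rintro f g ⟨C, hC⟩ ⟨D, hD⟩
    refine ⟨C + D, fun φ => ?_⟩
    calc ‖(f + g) φ‖ ≤ ‖f φ‖ + ‖g φ‖ := norm_add_le _ _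
      _ ≤ (C + D) * sobolevNorm s φ := by linarith [hC φ, hD φ]
  zero_mem' := ⟨0, fun φ => by simp⟩
  smul_mem' := by
    rintro c f ⟨C, hC⟩
    refine ⟨‖c‖ * C, fun φ => ?_⟩
    calc ‖(c • f) φ‖ = ‖c‖ * ‖f φ‖ := norm_smul c (f φ)
      _ ≤ ‖c‖ * C * sobolevNorm s φ := by
        rw [mul_assoc]
        exact mul_le_mul_of_nonneg_left (hC φ) (norm_nonneg c)

/-- The space `H⁻ˢ(ℝ²)`, the dual of `Hˢ(ℝ²)`. A bounded functional on `Hˢ(ℝ²)` is determined by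
its restriction to the dense subspace of test functions, so it is a tempered distribution that
is bounded with respect to the norm of `Hˢ(ℝ²)`. -/
def NegSobolev (s : ℕ) : Type := ↥(negSobolevSubmodule s)

namespace NegSobolev

instance (s : ℕ) : AddCommGroup (NegSobolev s) :=
  inferInstanceAs (AddCommGroup ↥(negSobolevSubmodule s))

instance (s : ℕ) : Module ℂ (NegSobolev s) :=
  inferInstanceAs (Module ℂ ↥(negSobolevSubmodule s))

/-- An element of `H⁻ˢ(ℝ²)` as a tempered distribution. -/
def toDistribution {s : ℕ} : NegSobolev s →ₗ[ℂ] 𝓢'(Plane, ℂ) :=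
  (negSobolevSubmodule s).subtype

theorem toDistribution_injective {s : ℕ} :
    Function.Injective (toDistribution : NegSobolev s → 𝓢'(Plane, ℂ)) :=
  Subtype.val_injective

/-- The norm of the dual space of `Hˢ(ℝ²)`. -/
instance (s : ℕ) : Norm (NegSobolev s) where
  norm f := ⨆ φ : {φ : 𝓢(Plane, ℂ) // sobolevNorm s φ ≤ 1}, ‖toDistribution f φ.1‖

theorem norm_def {s : ℕ} (f : NegSobolev s) :
    ‖f‖ = ⨆ φ : {φ : 𝓢(Plane, ℂ) // sobolevNorm s φ ≤ 1}, ‖toDistribution f φ.1‖ :=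
  rfl

theorem sobolevNorm_zero_le (s : ℕ) : sobolevNorm s 0 ≤ 1 := by
  have h := sobolevNorm_smul s 0 0
  rw [zero_smul] at h
  rw [h]
  simp

instance (s : ℕ) : Nonempty {φ : 𝓢(Plane, ℂ) // sobolevNorm s φ ≤ 1} :=
  ⟨⟨0, sobolevNorm_zero_le s⟩⟩

theorem bddAbove {s : ℕ} (f : NegSobolev s) :
    BddAbove (Set.range fun φ : {φ : 𝓢(Plane, ℂ) // sobolevNorm s φ ≤ 1} =>
      ‖toDistribution f φ.1‖) := by
  obtain ⟨C, hC⟩ := f.2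
  refine ⟨max C 0, ?_⟩
  rintro _ ⟨φ, rfl⟩
  have h0 := sobolevNorm_nonneg s φ.1
  calc ‖toDistribution f φ.1‖ ≤ C * sobolevNorm s φ.1 := hC φ.1
    _ ≤ max C 0 * sobolevNorm s φ.1 := mul_le_mul_of_nonneg_right (le_max_left _ _) h0
    _ ≤ max C 0 * 1 := mul_le_mul_of_nonneg_left φ.2 (le_max_right _ _)
    _ = max C 0 := mul_one _

theorem normedSpaceCore (s : ℕ) : NormedSpace.Core ℂ (NegSobolev s) where
  norm_nonneg f := Real.iSup_nonneg fun φ => norm_nonneg _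
  norm_smul c f := by
    simp only [norm_def, map_smul]
    rw [Real.mul_iSup_of_nonneg (norm_nonneg c)]
    exact iSup_congr fun φ => norm_smul c (toDistribution f φ.1)
  norm_triangle f g := by
    simp only [norm_def]
    refine ciSup_le fun φ => ?_
    rw [map_add]
    exact (norm_add_le (toDistribution f φ.1) (toDistribution g φ.1)).trans
      (add_le_add (le_ciSup (bddAbove f) φ) (le_ciSup (bddAbove g) φ))
  norm_eq_zero_iff f := by
    constructor
    · intro h
      apply toDistribution_injective
      rw [map_zero]
      ext φ
      have hn := sobolevNorm_nonneg s φ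
      have hpos : 0 < 1 + sobolevNorm s φ := by linarith
      set c : ℂ := (((1 + sobolevNorm s φ)⁻¹ : ℝ) : ℂ) with hc
      have hc0 : c ≠ 0 := by
        rw [hc]
        exact_mod_cast (inv_pos.mpr hpos).ne'
      have hball : sobolevNorm s (c • φ) ≤ 1 := by
        rw [sobolevNorm_smul, hc, Complex.norm_real, Real.norm_of_nonneg (inv_pos.mpr hpos).le,
          inv_mul_le_iff₀ hpos]
        linarith
      have hle : ‖toDistribution f (c • φ)‖ ≤ ‖f‖ := le_ciSup (bddAbove f) ⟨c • φ, hball⟩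
      rw [h, map_smul] at hle
      have hz := norm_le_zero_iff.mp hle
      simpa [hc0] using hz
    · rintro rfl
      rw [norm_def]
      simp

instance (s : ℕ) : NormedAddCommGroup (NegSobolev s) :=
  NormedAddCommGroup.ofCore (normedSpaceCore s)

instance (s : ℕ) : NormedSpace ℂ (NegSobolev s) :=
  NormedSpace.ofCore (normedSpaceCore s)

end NegSobolev

/-! ### The control system `W_t = Δ W - 2 δ u(t)`, `W(0) = W⁰` -/

/-- The controls: the functions of class `L^∞(0, T)`. -/
def controls (T : ℝ) : Set (ℝ → ℂ) :=
  {u | MemLp u ∞ (volume.restrict (Ioo 0 T))}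

/-- The controls with real values. -/
def realControls (T : ℝ) : Set (ℝ → ℂ) :=
  {u | u ∈ controls T ∧ ∀ᵐ t ∂(volume.restrict (Ioo 0 T)), (u t).im = 0}

/-- `W` is a solution on `[0, T]` of `W_t = Δ W - 2 δ u(t)`, `W(0) = W⁰`: its values on `[0, T]`
belong to `Ĥ⁰(ℝ²)`; as a function with values in `H⁻²(ℝ²)` it is absolutely continuous on `[0, T]`;
and for almost all `t` it has at `t` a derivative in `Ĥ⁻²(ℝ²)`, which equals `Δ W(t) - 2 u(t) δ`. -/
structure IsSolution (T : ℝ) (u : ℝ → ℂ) (W₀ : EvenL2) (W : ℝ → EvenL2) : Prop where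
  /-- The initial condition. -/
  initial : W 0 = W₀
  /-- The equation, for the path `V` in `H⁻²(ℝ²)` that consists of the same distributions. -/
  equation : ∃ V : ℝ → NegSobolev 2,
    (∀ t ∈ Icc 0 T, (V t).toDistribution = ((W t : L2) : 𝓢'(Plane, ℂ))) ∧
    AbsolutelyContinuousOnInterval V 0 T ∧
    ∀ᵐ t ∂(volume.restrict (Ioo 0 T)), ∃ V' : NegSobolev 2,
      HasDerivAt V V' t ∧ IsEven V'.toDistribution ∧
      V'.toDistribution = Δ ((W t : L2) : 𝓢'(Plane, ℂ)) -
        (2 * u t) • TemperedDistribution.delta (0 : Plane)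

/-- The set of the states in `Ĥ⁰(ℝ²)` that are reachable from `W₀` in time `T` by controls of the
class `U`: the system has a solution, unique on `[0, T]`, and this solution has the given end
state. -/
def reachable (U : Set (ℝ → ℂ)) (T : ℝ) (W₀ : EvenL2) : Set EvenL2 :=
  {Wend | ∃ u ∈ U, ∃ W : ℝ → EvenL2, IsSolution T u W₀ W ∧
    (∀ W' : ℝ → EvenL2, IsSolution T u W₀ W' → EqOn W' W (Icc 0 T)) ∧ W T = Wend}

/-- `W₀` is approximately controllable to `Wend` in time `T` by controls of the class `U`: the state
`Wend` belongs to the closure in `Ĥ⁰(ℝ²)` of the set of reachable states. -/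
def ApproxControllable (U : Set (ℝ → ℂ)) (T : ℝ) (W₀ Wend : EvenL2) : Prop :=
  Wend ∈ closure (reachable U T W₀)

/-! ### The free heat evolution and the space `𝓗` -/

/-- The heat kernel `(4πt)⁻¹ exp (-|x|²/(4t))` of the plane. -/
def heatKernel (t : ℝ) (x : Plane) : ℝ :=
  1 / (4 * Real.pi * t) * Real.exp (-‖x‖ ^ 2 / (4 * t))

/-- The free heat evolution of `W₀` at time `t > 0`: the convolution of the heat kernel
with `W₀`. -/
def freeHeat (t : ℝ) (W₀ : EvenL2) : Plane → ℂ :=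
  heatKernel t ⋆[ContinuousLinearMap.lsmul ℝ ℝ, volume] ((W₀ : L2) : Plane → ℂ)

/-- `f` belongs to `𝓗`: it is square integrable on `ℝ²` and `f(x) = g(|x|²)` for almost all `x`,
with some `g` in `L²(0, ∞)`. -/
def MemRadial (f : Plane → ℂ) : Prop :=
  MemLp f 2 (volume : Measure Plane) ∧
    ∃ g : ℝ → ℂ, MemLp g 2 (volume.restrict (Ioi 0)) ∧ ∀ᵐ x : Plane, f x = g (‖x‖ ^ 2)

/-- The values of a state are real almost everywhere. -/
def IsRealValued (f : EvenL2) : Prop :=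
  ∀ᵐ x : Plane, (((f : L2) : Plane → ℂ) x).im = 0

end HeatControl

end

noncomputable section

namespace HeatControl

open MeasureTheory Set Filter Topology
open scoped SchwartzMap LineDeriv Laplacian ENNReal Convolution
open scoped FourierTransform NNReal

/-! ### The image of the Lebesgue measure under `x ↦ ‖x‖²` -/

/-! With `λ = 4π²‖ξ‖²`, the Fourier transform turns the equation into the scalar equations `w' = -λ
w - 2u`, because `δ` has the constant transform 1. The end state is therefore the free evolution of
`W₀`, which does not depend on `u`, plus the inverse transform of `-2 ∫₀ᵀ exp (-λ (T - s)) u(s) ds`.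
By `freeHeat_ae_eq` the free part is the heat kernel convolution, so the question is which functions
are limits of control terms (`approxControllable_iff`).

Necessity: the symbol of a control term depends on `‖ξ‖` alone, the Fourier transform preserves
radial functions, and these form a closed subspace of `L²(ℝ²)`.

Sufficiency: controls concentrating at time `T - s` produce in the limit every `exp (-s λ)` with `0
< s < T`, that is, up to constants, every Gaussian `exp (-p ‖x‖²)` with `p > 1 / (4T)`. These
Gaussians are total among the radial functions: in the variable `r = ‖x‖²` they are exponentials,
and a function orthogonal to all of them has a Laplace transform vanishing along an arithmetic
progression, hence is zero by a Stone-Weierstrass argument (`ext_of_laplace`). Real controls give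
only a real subspace, but the Gaussians are real, so taking real parts of complex approximations
suffices.

Well-posedness is part of the definition of a reachable state. For existence, the transformed
solution times `(1 + λ)⁻¹` is Lipschitz in `L²`, and `1 - Δ` maps `L²` boundedly to `H⁻²`
(`isSolution_solution`). For uniqueness, the difference of two solutions is tested against
band-limited functions, on which `Δ` is bounded (`eq_zero_of_heat_equation`). -/

theorem measurePreserving_norm_sq :
    MeasurePreserving (fun x : Plane => ‖x‖ ^ 2) volume
      (ENNReal.ofReal Real.pi • volume.restrict (Ioi (0 : ℝ))) := by
  refine ⟨by fun_prop, ?_⟩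
  have hm : Measurable (fun x : Plane => ‖x‖ ^ 2) := by fun_prop
  have hball (b : ℝ) : volume (Metric.ball (0 : Plane) (√b)) =
      ENNReal.ofReal b * ENNReal.ofReal Real.pi := by
    rw [EuclideanSpace.volume_ball_fin_two, ← ENNReal.ofReal_pow (Real.sqrt_nonneg b)]
    congr 1
    rcases le_total 0 b with hb | hb
    · rw [Real.sq_sqrt hb]
    · rw [Real.sqrt_eq_zero_of_nonpos hb, ENNReal.ofReal_of_nonpos hb]
      simp
  -- The preimage of `Ico a b` is an annulus. Since `√a = 0` for negative `a`, the inner disc is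
  -- then empty, whence `max a 0`.
  have hpre (a b : ℝ) (hab : a < b) :
      Measure.map (fun x : Plane => ‖x‖ ^ 2) volume (Ico a b) =
        ENNReal.ofReal Real.pi * ENNReal.ofReal (b - max a 0) := by
    have hset : (fun x : Plane => ‖x‖ ^ 2) ⁻¹' Ico a b =
        Metric.ball 0 (√b) \ Metric.ball 0 (√a) := by
      ext x
      simp only [mem_preimage, mem_Ico, Set.mem_sdiff, mem_ball_zero_iff, Real.lt_sqrt (norm_nonneg x),
        not_lt]
      tauto
    rw [Measure.map_apply hm measurableSet_Ico, hset,
      measure_sdiff (Metric.ball_subset_ball (Real.sqrt_le_sqrt hab.le))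
        measurableSet_ball.nullMeasurableSet measure_ball_lt_top.ne, hball, hball,
      ← ENNReal.sub_mul (fun _ _ => ENNReal.ofReal_ne_top),
      ENNReal.ofReal_sub _ (le_max_right a 0), mul_comm]
    congr 2
    rcases le_total 0 a with ha | ha
    · rw [max_eq_left ha]
    · rw [max_eq_right ha, ENNReal.ofReal_of_nonpos ha, ENNReal.ofReal_zero]
  refine Measure.ext_of_Ico' _ _ (fun a b hab => ?_) (fun a b hab => ?_)
  · rw [hpre a b hab]
    exact ENNReal.mul_ne_top ENNReal.ofReal_ne_top ENNReal.ofReal_ne_top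
  · rw [hpre a b hab, Measure.smul_apply, smul_eq_mul, restrict_Ioi_eq_restrict_Ici,
      Measure.restrict_apply measurableSet_Ico]
    congr 1
    have : Ico a b ∩ Ici 0 = Ico (max a 0) b := by
      ext x
      simp only [mem_inter_iff, mem_Ico, mem_Ici, max_le_iff]
      tauto
    rw [this, Real.volume_Ico]

/-- The map `x ↦ ‖x‖²` with values in `ℝ≥0`. -/
def normSq (x : Plane) : ℝ≥0 := ‖x‖₊ ^ 2

theorem coe_normSq (x : Plane) : (normSq x : ℝ) = ‖x‖ ^ 2 := by simp [normSq]

theorem measurable_normSq : Measurable normSq := by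
  unfold normSq
  fun_prop

/-- The image of the Lebesgue measure under `x ↦ ‖x‖²`, on `ℝ≥0`. -/
def radialMeasure : Measure ℝ≥0 := volume.map normSq

theorem measurePreserving_normSq : MeasurePreserving normSq volume radialMeasure :=
  measurable_normSq.measurePreserving _

/-- Radial profiles are handled on `ℝ≥0`, where `r ↦ exp (-r)` is bounded. This map and
`measurePreserving_toNNReal` translate to and from the profiles on `(0, ∞)` in `MemRadial`. -/
theorem measurePreserving_coe : MeasurePreserving ((↑) : ℝ≥0 → ℝ) radialMeasure
    (ENNReal.ofReal Real.pi • volume.restrict (Ioi (0 : ℝ))) := by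
  refine ⟨measurable_coe_nnreal_real, ?_⟩
  rw [← measurePreserving_norm_sq.map_eq, radialMeasure,
    Measure.map_map measurable_coe_nnreal_real measurable_normSq]
  congr 1

theorem measurePreserving_toNNReal : MeasurePreserving Real.toNNReal
    (ENNReal.ofReal Real.pi • volume.restrict (Ioi (0 : ℝ))) radialMeasure := by
  refine ⟨measurable_real_toNNReal, ?_⟩
  rw [← measurePreserving_norm_sq.map_eq, radialMeasure,
    Measure.map_map measurable_real_toNNReal measurePreserving_norm_sq.measurable]
  congr 1
  ext x
  simp [← coe_normSq]

/-! ### Radial functions -/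

/-- The isometric embedding `g ↦ g (‖·‖²)`. -/
def radialEmbedding : Lp ℂ 2 radialMeasure →ₗᵢ[ℂ] L2 :=
  Lp.compMeasurePreservingₗᵢ ℂ normSq measurePreserving_normSq

theorem coeFn_radialEmbedding (g : Lp ℂ 2 radialMeasure) :
    radialEmbedding g =ᵐ[volume] g ∘ normSq :=
  Lp.coeFn_compMeasurePreserving g measurePreserving_normSq

/-- The closed subspace of the radial elements of `L²(ℝ²)`. -/
def radialSubmodule : Submodule ℂ L2 := LinearMap.range radialEmbedding.toLinearMap

theorem isClosed_radialSubmodule : IsClosed (radialSubmodule : Set L2) := by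
  have : (radialSubmodule : Set L2) = range radialEmbedding := by
    simp [radialSubmodule, LinearMap.coe_range]
  rw [this]
  exact radialEmbedding.isometry.isClosedEmbedding.isClosed_range

theorem memLp_comp_normSq {h : ℝ≥0 → ℂ} (hh : AEStronglyMeasurable h radialMeasure)
    (hL : MemLp (h ∘ normSq) 2 (volume : Measure Plane)) : MemLp h 2 radialMeasure :=
  ⟨hh, by rw [← eLpNorm_comp_measurePreserving hh measurePreserving_normSq]; exact hL.2⟩

theorem toLp_mem_radialSubmodule {h : ℝ≥0 → ℂ} (hh : MemLp h 2 radialMeasure) {f : L2}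
    (hf : f =ᵐ[volume] h ∘ normSq) : f ∈ radialSubmodule := by
  refine ⟨hh.toLp h, ?_⟩
  refine Lp.ext ?_
  refine (coeFn_radialEmbedding _).trans (EventuallyEq.trans ?_ hf.symm)
  exact measurePreserving_normSq.quasiMeasurePreserving.ae_eq hh.coeFn_toLp

/-- The image measure differs from the Lebesgue measure on `(0, ∞)` by the finite nonzero factor
`π`, which does not affect square integrability. -/
theorem memRadial_iff {F : Plane → ℂ} {f : L2} (h : F =ᵐ[volume] f) :
    MemRadial F ↔ f ∈ radialSubmodule := by
  have hpi : ENNReal.ofReal Real.pi ≠ 0 := by simp [Real.pi_pos]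
  constructor
  · rintro ⟨-, g, hg, hFg⟩
    have hg' : MemLp g 2 (ENNReal.ofReal Real.pi • volume.restrict (Ioi (0 : ℝ))) :=
      hg.smul_measure ENNReal.ofReal_ne_top
    refine toLp_mem_radialSubmodule (hg'.comp_measurePreserving measurePreserving_coe) ?_
    filter_upwards [h, hFg] with x hx hx'
    simp only [Function.comp_apply, coe_normSq]
    rw [← hx, hx']
  · rintro ⟨g, rfl⟩
    refine ⟨(memLp_congr_ae h).mpr (Lp.memLp _), g ∘ Real.toNNReal, ?_, ?_⟩
    · have := ((Lp.memLp g).comp_measurePreserving measurePreserving_toNNReal).smul_measure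
        (c := (ENNReal.ofReal Real.pi)⁻¹) (ENNReal.inv_ne_top.mpr hpi)
      rwa [smul_smul, ENNReal.inv_mul_cancel hpi ENNReal.ofReal_ne_top, one_smul] at this
    · filter_upwards [h, coeFn_radialEmbedding g] with x hx hx'
      rw [hx]
      refine hx'.trans ?_
      simp only [Function.comp_apply, ← coe_normSq, Real.toNNReal_coe]

/-! ### Uniqueness of the Laplace transform -/

/-- The bounded continuous function `r ↦ exp (-r)` on `ℝ≥0`. -/
def expNeg : BoundedContinuousFunction ℝ≥0 ℝ :=
  BoundedContinuousFunction.ofNormedAddCommGroup (fun r : ℝ≥0 => Real.exp (-r))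
    (by fun_prop) 1 (fun r => by simp)

theorem expNeg_pow_apply (n : ℕ) (r : ℝ≥0) : (expNeg ^ n) r = Real.exp (-(n * r)) := by
  rw [BoundedContinuousFunction.pow_apply]
  change Real.exp (-r) ^ n = _
  rw [← Real.exp_nat_mul]
  congr 1
  ring

/-- The algebra of the polynomials in `r ↦ exp (-r)`. -/
def expAlgebra : StarSubalgebra ℝ (BoundedContinuousFunction ℝ≥0 ℝ) where
  toSubalgebra := Algebra.adjoin ℝ {expNeg}
  star_mem' {f} hf := by
    have : star f = f := by
      ext x
      simp
    rwa [this]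

/-- The powers of `exp (-r)` span an algebra of bounded continuous functions that separates points,
and the integrals over such an algebra determine a finite measure on a Polish space. -/
theorem ext_of_laplace {P Q : Measure ℝ≥0} [IsFiniteMeasure P] [IsFiniteMeasure Q]
    (h : ∀ n : ℕ, ∫ r, Real.exp (-(n * r)) ∂P = ∫ r, Real.exp (-(n * r)) ∂Q) : P = Q := by
  refine ext_of_forall_mem_subalgebra_integral_eq_of_polish (A := expAlgebra) ?_ ?_
  · intro x y hxy
    refine ⟨_, ⟨_, ⟨expNeg, ?_, rfl⟩, rfl⟩, ?_⟩
    · exact Algebra.subset_adjoin (mem_singleton expNeg)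
    · change Real.exp (-x) ≠ Real.exp (-y)
      simpa using hxy
  · intro g hg
    have hg' : g ∈ Submodule.span ℝ
        (Submonoid.closure {expNeg} : Set (BoundedContinuousFunction ℝ≥0 ℝ)) := by
      rw [← Algebra.adjoin_eq_span]
      exact hg
    clear hg
    induction hg' using Submodule.span_induction with
    | mem f hf =>
      obtain ⟨n, rfl⟩ := Submonoid.mem_closure_singleton.mp hf
      simpa only [expNeg_pow_apply] using h n
    | zero => simp
    | add f g hf hg ihf ihg =>
      have e (μ : Measure ℝ≥0) [IsFiniteMeasure μ] :
          ∫ x, (f + g) x ∂μ = ∫ x, f x ∂μ + ∫ x, g x ∂μ :=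
        integral_add (f.integrable μ) (g.integrable μ)
      rw [e, e, ihf, ihg]
    | smul c f hf ih =>
      have e (μ : Measure ℝ≥0) [IsFiniteMeasure μ] :
          ∫ x, (c • f) x ∂μ = c • ∫ x, f x ∂μ := integral_smul c _
      rw [e, e, ih]

/-- The positive and negative parts of `g` are densities of finite measures with equal transforms,
so the two densities agree. The measure `ν` itself need not be finite. -/
theorem ae_eq_zero_of_laplace_real {ν : Measure ℝ≥0} {g : ℝ≥0 → ℝ} (hg : Integrable g ν)
    (h : ∀ n : ℕ, ∫ r, Real.exp (-(n * r)) * g r ∂ν = 0) : g =ᵐ[ν] 0 := by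
  wlog hm : Measurable g generalizing g
  · have hae := hg.1.ae_eq_mk
    refine hae.trans (this (hg.congr hae) (fun n => ?_) hg.1.stronglyMeasurable_mk.measurable)
    rw [← h n]
    refine integral_congr_ae ?_
    filter_upwards [hae] with r hr
    rw [hr]
  have hp : Measurable fun r => ENNReal.ofReal (g r) := by fun_prop
  have hn : Measurable fun r => ENNReal.ofReal (-g r) := by fun_prop
  have hfp : ∫⁻ r, ENNReal.ofReal (g r) ∂ν ≠ ⊤ := hg.lintegral_lt_top.ne
  have hfn : ∫⁻ r, ENNReal.ofReal (-g r) ∂ν ≠ ⊤ := hg.neg.lintegral_lt_top.ne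
  have : IsFiniteMeasure (ν.withDensity fun r => ENNReal.ofReal (g r)) :=
    isFiniteMeasure_withDensity hfp
  have : IsFiniteMeasure (ν.withDensity fun r => ENNReal.ofReal (-g r)) :=
    isFiniteMeasure_withDensity hfn
  have hbound (k : ℝ≥0 → ℝ) (hk : Integrable k ν) (n : ℕ) :
      Integrable (fun r : ℝ≥0 => k r * Real.exp (-(n * r))) ν := by
    refine hk.mul_bdd (c := 1) (by fun_prop) (Eventually.of_forall fun r => ?_)
    rw [Real.norm_of_nonneg (Real.exp_nonneg _)]
    exact Real.exp_le_one_iff.mpr (by simp [mul_nonneg])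
  have key : (ν.withDensity fun r => ENNReal.ofReal (g r)) =
      ν.withDensity fun r => ENNReal.ofReal (-g r) := by
    refine ext_of_laplace fun n => ?_
    rw [integral_withDensity_eq_integral_toReal_smul hp (by simp),
      integral_withDensity_eq_integral_toReal_smul hn (by simp), ← sub_eq_zero]
    simp only [ENNReal.toReal_ofReal', smul_eq_mul]
    rw [← integral_sub (hbound _ hg.pos_part n) (hbound _ hg.neg_part n)]
    refine Eq.trans ?_ (h n)
    refine integral_congr_ae (Eventually.of_forall fun r => ?_)
    have := max_zero_sub_max_neg_zero_eq_self (g r)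
    simp only
    rw [← sub_mul, this, mul_comm]
  rw [withDensity_eq_iff hp.aemeasurable hn.aemeasurable hfp] at key
  filter_upwards [key] with r hr
  have h1 := congrArg ENNReal.toReal hr
  simp only [ENNReal.toReal_ofReal'] at h1
  have := max_zero_sub_max_neg_zero_eq_self (g r)
  rw [← this, h1, sub_self]
  rfl

theorem ae_eq_zero_of_laplace {ν : Measure ℝ≥0} {g : ℝ≥0 → ℂ} (hg : Integrable g ν)
    (h : ∀ n : ℕ, ∫ r, (Real.exp (-(n * r)) : ℂ) * g r ∂ν = 0) : g =ᵐ[ν] 0 := by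
  have hint (n : ℕ) : Integrable (fun r : ℝ≥0 => (Real.exp (-(n * r)) : ℂ) * g r) ν := by
    refine hg.bdd_mul (c := 1) (by fun_prop) (Eventually.of_forall fun r => ?_)
    rw [Complex.norm_real, Real.norm_of_nonneg (Real.exp_nonneg _)]
    exact Real.exp_le_one_iff.mpr (by simp [mul_nonneg])
  have hre : (fun r => (g r).re) =ᵐ[ν] 0 := by
    refine ae_eq_zero_of_laplace_real hg.re fun n => ?_
    have := congrArg Complex.re (h n)
    rw [← RCLike.re_eq_complex_re, ← integral_re (hint n)] at this
    simpa only [RCLike.re_eq_complex_re, Complex.re_ofReal_mul, Complex.zero_re] using this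
  have him : (fun r => (g r).im) =ᵐ[ν] 0 := by
    refine ae_eq_zero_of_laplace_real hg.im fun n => ?_
    have := congrArg Complex.im (h n)
    rw [← RCLike.im_eq_complex_im, ← integral_im (hint n)] at this
    simpa only [RCLike.im_eq_complex_im, Complex.im_ofReal_mul, Complex.zero_im] using this
  filter_upwards [hre, him] with r h1 h2
  exact Complex.ext h1 h2

/-! ### Gaussians are total among the radial functions -/

theorem memLp_gaussian {p : ℝ} (hp : 0 < p) :
    MemLp (fun x : Plane => (Real.exp (-p * ‖x‖ ^ 2) : ℂ)) 2 volume := by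
  rw [memLp_two_iff_integrable_sq_norm (by fun_prop)]
  have h := (GaussianFourier.integrable_cexp_neg_mul_sq_norm_add (V := Plane)
    (b := ((2 * p : ℝ) : ℂ)) (by simpa using hp) 0 0).norm
  refine h.congr (Eventually.of_forall fun x => ?_)
  simp only [Complex.norm_exp, Complex.norm_real]
  rw [Real.norm_of_nonneg (Real.exp_nonneg _), ← Real.exp_nat_mul]
  congr 1
  simp [← Complex.ofReal_pow]
  ring

/-- The function `x ↦ exp (-p ‖x‖²)`, for `p > 0`. -/
def gaussian (p : ℝ) (hp : 0 < p) : L2 := (memLp_gaussian hp).toLp _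

theorem memLp_exp_neg {p : ℝ} (hp : 0 < p) :
    MemLp (fun r : ℝ≥0 => (Real.exp (-p * r) : ℂ)) 2 radialMeasure := by
  refine memLp_comp_normSq (by fun_prop) ?_
  simpa only [Function.comp_def, coe_normSq] using memLp_gaussian hp

theorem radialEmbedding_toLp_exp_neg {p : ℝ} (hp : 0 < p) :
    radialEmbedding ((memLp_exp_neg hp).toLp _) = gaussian p hp := by
  refine Lp.ext ?_
  refine (coeFn_radialEmbedding _).trans ?_
  refine (measurePreserving_normSq.quasiMeasurePreserving.ae_eq
    (memLp_exp_neg hp).coeFn_toLp).trans ?_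
  refine EventuallyEq.trans (Eventually.of_forall fun x => ?_) (memLp_gaussian hp).coeFn_toLp.symm
  simp only [Function.comp_apply, coe_normSq]

theorem gaussian_mem_radialSubmodule {p : ℝ} (hp : 0 < p) : gaussian p hp ∈ radialSubmodule :=
  ⟨_, radialEmbedding_toLp_exp_neg hp⟩

/-- The Gaussians `exp (-p ‖x‖²)` with `p > p₀`. -/
def gaussians (p₀ : ℝ) : Set L2 := {f | ∃ (p : ℝ) (hp : 0 < p), p₀ < p ∧ f = gaussian p hp}

theorem span_exp_neg_dense (p₀ : ℝ) :
    (Submodule.span ℂ {f : Lp ℂ 2 radialMeasure | ∃ (p : ℝ) (hp : 0 < p), p₀ < p ∧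
      f = (memLp_exp_neg hp).toLp _}).topologicalClosure = ⊤ := by
  rw [Submodule.topologicalClosure_eq_top_iff, Submodule.eq_bot_iff]
  intro h hh
  rw [Submodule.mem_orthogonal] at hh
  -- All exponents `p₁ + n` are positive and exceed `p₀`. Factoring out `exp (-p₁ r)` makes the
  -- product with `h` integrable and turns orthogonality into vanishing transforms at the integers.
  set p₁ : ℝ := max p₀ 0 + 1
  have hp₁ : 0 < p₁ := by positivity
  have hp₁' : p₀ < p₁ := lt_of_le_of_lt (le_max_left _ _) (lt_add_one _)
  have hint : Integrable (fun r : ℝ≥0 => (Real.exp (-p₁ * r) : ℂ) * h r) radialMeasure :=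
    (memLp_exp_neg hp₁).integrable_mul (Lp.memLp h)
  have hz := ae_eq_zero_of_laplace hint fun n => by
    have hpn : 0 < p₁ + n := by positivity
    have := hh _ (Submodule.subset_span ⟨p₁ + n, hpn, by linarith [n.cast_nonneg (α := ℝ)], rfl⟩)
    rw [L2.inner_def] at this
    rw [← this]
    refine integral_congr_ae ?_
    filter_upwards [(memLp_exp_neg hpn).coeFn_toLp] with r hr
    rw [hr, RCLike.inner_apply, Complex.conj_ofReal, ← mul_assoc, ← Complex.ofReal_mul,
      ← Real.exp_add, mul_comm]
    congr 4
    ring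
  rw [Lp.eq_zero_iff_ae_eq_zero]
  filter_upwards [hz] with r hr
  simpa using hr

/-- The threshold is needed because only the exponents above `1 / (4T)` are within reach of the
controls. -/
theorem radialSubmodule_le (p₀ : ℝ) :
    radialSubmodule ≤ (Submodule.span ℂ (gaussians p₀)).topologicalClosure := by
  rintro _ ⟨g, rfl⟩
  have hg : g ∈ closure (Submodule.span ℂ {f : Lp ℂ 2 radialMeasure |
      ∃ (p : ℝ) (hp : 0 < p), p₀ < p ∧ f = (memLp_exp_neg hp).toLp _} : Set _) := by
    rw [← Submodule.topologicalClosure_coe, span_exp_neg_dense]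
    trivial
  refine map_mem_closure radialEmbedding.continuous hg fun f hf => ?_
  have := Submodule.mem_map_of_mem (f := radialEmbedding.toLinearMap) hf
  rw [Submodule.map_span] at this
  refine Submodule.span_mono ?_ this
  rintro _ ⟨_, ⟨p, hp, hp', rfl⟩, rfl⟩
  exact ⟨p, hp, hp', radialEmbedding_toLp_exp_neg hp⟩

/-! ### The Fourier transform on `L²(ℝ²)` -/

theorem toDistribution_apply (f : L2) (φ : 𝓢(Plane, ℂ)) :
    (f : 𝓢'(Plane, ℂ)) φ = ∫ x, φ x * f x :=
  Lp.toTemperedDistribution_apply f φ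

theorem toTemperedDistribution_injective :
    Function.Injective (fun f : L2 => (f : 𝓢'(Plane, ℂ))) :=
  LinearMap.ker_eq_bot.mp (Lp.ker_toTemperedDistributionCLM_eq_bot (F := ℂ) (μ := volume)
    (E := Plane) (p := 2))

theorem toDistribution_fourierInv (g : L2) (φ : 𝓢(Plane, ℂ)) :
    ((𝓕⁻ g : L2) : 𝓢'(Plane, ℂ)) φ = (g : 𝓢'(Plane, ℂ)) (𝓕⁻ φ) := by
  rw [← Lp.fourierInv_toTemperedDistribution_eq, TemperedDistribution.fourierInv_apply]

theorem toDistribution_fourier (g : L2) (φ : 𝓢(Plane, ℂ)) :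
    ((𝓕 g : L2) : 𝓢'(Plane, ℂ)) φ = (g : 𝓢'(Plane, ℂ)) (𝓕 φ) := by
  rw [← Lp.fourier_toTemperedDistribution_eq, TemperedDistribution.fourier_apply]

theorem inner_fourierInv_left (f g : L2) : inner ℂ (𝓕⁻ f) g = inner ℂ f (𝓕 g) := by
  rw [← Lp.inner_fourier_eq, FourierTransform.fourier_fourierInv_eq]

theorem integral_mul_fourierInv {f g : Plane → ℂ} (hf : Integrable f) (hg : Integrable g) :
    ∫ x, f x * 𝓕⁻ g x = ∫ x, 𝓕⁻ f x * g x := by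
  -- The inverse transform is the Fourier integral for the symmetric form `-⟪x, y⟫`, so flipping the
  -- form changes nothing.
  have := VectorFourier.integral_fourierIntegral_smul_eq_flip (𝕜 := ℝ) (V := Plane) (W := Plane)
    (F := ℂ) (e := Real.fourierChar) (μ := volume) (ν := volume) (L := -innerₗ Plane)
    (f := f) (g := g) Real.continuous_fourierChar (by
      change Continuous fun p : Plane × Plane => -inner ℝ p.1 p.2
      fun_prop) hf hg
  have hflip : (-innerₗ Plane).flip = -innerₗ Plane := by
    ext x y
    simp [real_inner_comm]
  rw [hflip] at this
  exact this.symm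

theorem continuous_fourierInv {g : Plane → ℂ} (hg : Integrable g) : Continuous (𝓕⁻ g) :=
  VectorFourier.fourierIntegral_continuous Real.continuous_fourierChar (by
    change Continuous fun p : Plane × Plane => -inner ℝ p.1 p.2
    fun_prop) hg

/-- Both sides have the same integrals against compactly supported smooth functions, since in either
case the transform can be moved onto the test function. -/
theorem coeFn_fourierInv_toLp {h : Plane → ℂ} (h2 : MemLp h 2 volume) (h1 : Integrable h) :
    (𝓕⁻ (h2.toLp h) : L2) =ᵐ[volume] 𝓕⁻ h := by
  refine ae_eq_of_integral_contDiff_smul_eq ((Lp.memLp _).locallyIntegrable one_le_two)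
    (continuous_fourierInv h1).locallyIntegrable fun g hg hgc => ?_
  have hg₁ : HasCompactSupport (Complex.ofRealCLM ∘ g) := hgc.comp_left rfl
  have hg₂ : ContDiff ℝ (↑(⊤ : ℕ∞)) (Complex.ofRealCLM ∘ g) := by fun_prop
  set φ : 𝓢(Plane, ℂ) := hg₁.toSchwartzMap hg₂
  calc ∫ x, g x • (𝓕⁻ (h2.toLp h) : L2) x = ((𝓕⁻ (h2.toLp h) : L2) : 𝓢'(Plane, ℂ)) φ := by
        rw [toDistribution_apply]
        rfl
    _ = ∫ x, 𝓕⁻ φ x * (h2.toLp h : L2) x := by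
        rw [toDistribution_fourierInv, toDistribution_apply]
    _ = ∫ x, 𝓕⁻ (φ : Plane → ℂ) x * h x := by
        refine integral_congr_ae ?_
        filter_upwards [h2.coeFn_toLp] with x hx
        rw [hx, SchwartzMap.fourierInv_coe]
    _ = ∫ x, φ x * 𝓕⁻ h x := (integral_mul_fourierInv φ.integrable h1).symm
    _ = ∫ x, g x • 𝓕⁻ h x := rfl

/-! ### Gaussians and the free heat evolution -/

/-- The symbol `4π²‖ξ‖²` of the operator `-Δ`. -/
def symbol (ξ : Plane) : ℝ := (2 * Real.pi) ^ 2 * ‖ξ‖ ^ 2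

theorem symbol_nonneg (ξ : Plane) : 0 ≤ symbol ξ := by
  unfold symbol
  positivity

theorem continuous_symbol : Continuous symbol := by
  unfold symbol
  fun_prop

/-- For `b = (2π)² T` the right side is the translated heat kernel `heatKernel T (x - y)`. -/
theorem fourierInv_shifted_gaussian {b : ℝ} (hb : 0 < b) (x y : Plane) :
    𝓕⁻ (fun v : Plane => Complex.exp (-b * ‖v‖ ^ 2 + 2 * Real.pi * Complex.I * inner ℝ (-x) v)) y =
      (Real.pi / b * Real.exp (-Real.pi ^ 2 / b * ‖x - y‖ ^ 2) : ℝ) := by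
  rw [Real.fourierInv_eq_fourier_neg, fourier_gaussian_innerProductSpace' (by simpa using hb),
    show -x - -y = -(x - y) by abel, norm_neg]
  simp only [finrank_euclideanSpace, Fintype.card_fin]
  push_cast
  rw [div_self two_ne_zero, Complex.cpow_one]
  congr 2
  ring

theorem integrable_shifted_gaussian {b : ℝ} (hb : 0 < b) (x : Plane) :
    Integrable (fun v : Plane =>
      Complex.exp (-b * ‖v‖ ^ 2 + 2 * Real.pi * Complex.I * inner ℝ (-x) v)) :=
  GaussianFourier.integrable_cexp_neg_mul_sq_norm_add (by simpa using hb) _ _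

theorem memLp_shifted_gaussian {b : ℝ} (hb : 0 < b) (x : Plane) :
    MemLp (fun v : Plane =>
      Complex.exp (-b * ‖v‖ ^ 2 + 2 * Real.pi * Complex.I * inner ℝ (-x) v)) 2 volume := by
  refine (memLp_gaussian hb).of_le (by fun_prop) (Eventually.of_forall fun v => le_of_eq ?_)
  rw [Complex.norm_exp, Complex.norm_real, Real.norm_of_nonneg (Real.exp_nonneg _)]
  congr 1
  simp [← Complex.ofReal_pow]

theorem fourierInv_gaussian {b : ℝ} (hb : 0 < b) :
    (𝓕⁻ (gaussian b hb) : L2) =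
      ((Real.pi / b : ℝ) : ℂ) • gaussian (Real.pi ^ 2 / b) (by positivity) := by
  have h1 : (fun v : Plane =>
      Complex.exp (-b * ‖v‖ ^ 2 + 2 * Real.pi * Complex.I * inner ℝ (-(0 : Plane)) v)) =
      fun v => (Real.exp (-b * ‖v‖ ^ 2) : ℂ) := by
    ext v
    push_cast
    simp
  refine Lp.ext ?_
  have hi := integrable_shifted_gaussian hb 0
  rw [h1] at hi
  refine (coeFn_fourierInv_toLp (memLp_gaussian hb) hi).trans ?_
  filter_upwards [Lp.coeFn_smul ((Real.pi / b : ℝ) : ℂ)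
    (gaussian (Real.pi ^ 2 / b) (by positivity)), (memLp_gaussian (p := Real.pi ^ 2 / b)
    (by positivity)).coeFn_toLp] with y hy hy'
  rw [hy, Pi.smul_apply, gaussian, hy', ← h1, fourierInv_shifted_gaussian hb]
  push_cast
  simp [neg_div]

/-- Multiplication by `exp (-t λ)`, where `λ` is the symbol of `-Δ`. -/
theorem memLp_exp_symbol_mul {t : ℝ} (ht : 0 ≤ t) (f : L2) :
    MemLp (fun ξ : Plane => (Real.exp (-t * symbol ξ) : ℂ) * f ξ) 2 volume := by
  refine (Lp.memLp f).of_le ?_ (Eventually.of_forall fun ξ => ?_)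
  · have := continuous_symbol
    exact (by fun_prop : Continuous fun ξ : Plane =>
      (Real.exp (-t * symbol ξ) : ℂ)).aestronglyMeasurable.mul (Lp.aestronglyMeasurable f)
  · rw [norm_mul, Complex.norm_real, Real.norm_of_nonneg (Real.exp_nonneg _)]
    refine mul_le_of_le_one_left (norm_nonneg _) (Real.exp_le_one_iff.mpr ?_)
    nlinarith [symbol_nonneg ξ]

/-- The convolution at `x` is the inner product of a translated kernel with `W₀`. By Plancherel it
equals an inner product on the Fourier side, which is the inverse Fourier integral at `x`. -/
theorem freeHeat_ae_eq {T : ℝ} (hT : 0 < T) (W₀ : EvenL2) :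
    freeHeat T W₀ =ᵐ[volume]
      (𝓕⁻ ((memLp_exp_symbol_mul hT.le (𝓕 (W₀ : L2))).toLp _) : L2) := by
  have hb : 0 < (2 * Real.pi) ^ 2 * T := by positivity
  have hexp (ξ : Plane) : Real.exp (-T * symbol ξ) =
      Real.exp (-((2 * Real.pi) ^ 2 * T) * ‖ξ‖ ^ 2) := by
    rw [symbol]
    congr 1
    ring
  have hint : Integrable (fun ξ : Plane =>
      (Real.exp (-T * symbol ξ) : ℂ) * (𝓕 (W₀ : L2) : L2) ξ) := by
    simp only [hexp]
    exact (memLp_gaussian hb).integrable_mul (Lp.memLp _)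
  refine EventuallyEq.trans (Eventually.of_forall fun x => ?_)
    (coeFn_fourierInv_toLp (memLp_exp_symbol_mul hT.le (𝓕 (W₀ : L2))) hint).symm
  have hE := memLp_shifted_gaussian hb x
  have hk := coeFn_fourierInv_toLp hE (integrable_shifted_gaussian hb x)
  rw [freeHeat, convolution_eq_swap]
  calc ∫ y, (ContinuousLinearMap.lsmul ℝ ℝ (heatKernel T (x - y))) ((W₀ : L2) y)
      = inner ℂ (𝓕⁻ (hE.toLp _) : L2) (W₀ : L2) := by
        rw [L2.inner_def]
        refine integral_congr_ae ?_
        filter_upwards [hk] with y hy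
        rw [hy, fourierInv_shifted_gaussian hb, RCLike.inner_apply, Complex.conj_ofReal, mul_comm,
          ContinuousLinearMap.lsmul_apply, Complex.real_smul, heatKernel]
        congr 2
        have := Real.pi_pos
        congr 1
        · field_simp
          ring
        · congr 1
          field_simp
          ring
    _ = inner ℂ (hE.toLp _) (𝓕 (W₀ : L2)) := inner_fourierInv_left _ _
    _ = _ := by
        rw [L2.inner_def, Real.fourierInv_eq']
        refine integral_congr_ae ?_
        filter_upwards [hE.coeFn_toLp] with ξ hξ
        rw [hξ, RCLike.inner_apply, hexp, smul_eq_mul, mul_comm, ← mul_assoc]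
        congr 1
        rw [← Complex.exp_conj, Complex.ofReal_exp, ← Complex.exp_add]
        congr 1
        simp only [map_add, map_mul, map_neg, map_pow, Complex.conj_ofReal, Complex.conj_I,
          inner_neg_left, map_ofNat]
        push_cast
        rw [real_inner_comm]
        ring

/-! ### The Fourier transform of test functions -/

theorem fourierInv_laplacian (φ : 𝓢(Plane, ℂ)) (ξ : Plane) :
    𝓕⁻ (Δ φ) ξ = -(symbol ξ : ℂ) * 𝓕⁻ φ ξ := by
  rw [SchwartzMap.fourierInv_apply_eq, SchwartzMap.fourierInv_apply_eq]
  simp only [SchwartzMap.compCLMOfContinuousLinearEquiv_apply, Function.comp_apply]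
  rw [SchwartzMap.laplacian_eq_fourierMultiplierCLM, FourierTransform.fourier_smul,
    SchwartzMap.fourierMultiplierCLM_apply, FourierTransform.fourier_fourierInv_eq,
    smul_apply, SchwartzMap.smulLeftCLM_apply_apply (by fun_prop)]
  simp [symbol]
  ring

/-- In this form `δ` acts on the Fourier side as the constant symbol 1. -/
theorem apply_zero_eq_integral (φ : 𝓢(Plane, ℂ)) : φ 0 = ∫ ξ, 𝓕⁻ φ ξ := by
  conv_lhs => rw [← FourierTransform.fourier_fourierInv_eq (E := 𝓢(Plane, ℂ)) (F := 𝓢(Plane, ℂ)) φ,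
    SchwartzMap.fourier_coe,
    Real.fourier_eq]
  simp

/-! ### Evenness -/

theorem reflect_reflect (x : Plane) : reflect (reflect x) = x := by
  rw [reflect_apply, reflect_apply]
  ext i
  fin_cases i <;> simp

theorem measurePreserving_reflect : MeasurePreserving reflect volume volume :=
  reflect.measurePreserving

/-- The reflection of an element of `L²(ℝ²)`. -/
def reflectL2 (f : L2) : L2 := Lp.compMeasurePreserving reflect measurePreserving_reflect f

theorem coeFn_reflectL2 (f : L2) : reflectL2 f =ᵐ[volume] f ∘ reflect :=
  Lp.coeFn_compMeasurePreserving f measurePreserving_reflect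

theorem toDistribution_reflectL2 (f : L2) (φ : 𝓢(Plane, ℂ)) :
    (reflectL2 f : 𝓢'(Plane, ℂ)) φ = (f : 𝓢'(Plane, ℂ)) (reflectTest φ) := by
  rw [toDistribution_apply, toDistribution_apply,
    ← measurePreserving_reflect.integral_comp reflect.toHomeomorph.measurableEmbedding]
  refine integral_congr_ae ?_
  filter_upwards [measurePreserving_reflect.quasiMeasurePreserving.ae_eq (coeFn_reflectL2 f)]
    with x hx
  have hx' : reflectL2 f (reflect x) = f (reflect (reflect x)) := hx
  rw [hx', reflect_reflect]
  rfl

theorem mem_evenL2_iff (f : L2) : f ∈ EvenL2 ↔ reflectL2 f = f := by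
  constructor
  · intro h
    refine toTemperedDistribution_injective ?_
    ext φ
    exact (toDistribution_reflectL2 f φ).trans (h φ).symm
  · intro h φ
    rw [← toDistribution_reflectL2, h]

theorem reflectTest_fourierInv (φ : 𝓢(Plane, ℂ)) :
    reflectTest (𝓕⁻ φ) = 𝓕⁻ (reflectTest φ) := by
  ext x
  change (𝓕⁻ φ) (reflect x) = _
  rw [SchwartzMap.fourierInv_coe, SchwartzMap.fourierInv_coe]
  exact (Real.fourierInv_comp_linearIsometry reflect φ x).symm

theorem reflectTest_fourier (φ : 𝓢(Plane, ℂ)) : reflectTest (𝓕 φ) = 𝓕 (reflectTest φ) := by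
  ext x
  change (𝓕 φ) (reflect x) = _
  rw [SchwartzMap.fourier_coe, SchwartzMap.fourier_coe]
  exact (Real.fourier_comp_linearIsometry reflect φ x).symm

theorem fourierInv_mem_evenL2 {f : L2} (hf : f ∈ EvenL2) : (𝓕⁻ f : L2) ∈ EvenL2 := by
  intro φ
  rw [toDistribution_fourierInv, toDistribution_fourierInv, hf, reflectTest_fourierInv]

theorem fourier_mem_evenL2 {f : L2} (hf : f ∈ EvenL2) : (𝓕 f : L2) ∈ EvenL2 := by
  intro φ
  rw [toDistribution_fourier, toDistribution_fourier, hf, reflectTest_fourier]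

theorem toLp_mem_evenL2 {h : Plane → ℂ} (h2 : MemLp h 2 volume)
    (hh : ∀ᵐ x, h (reflect x) = h x) : h2.toLp h ∈ EvenL2 := by
  rw [mem_evenL2_iff]
  refine Lp.ext ?_
  filter_upwards [coeFn_reflectL2 (h2.toLp h), h2.coeFn_toLp, hh,
    measurePreserving_reflect.quasiMeasurePreserving.ae_eq h2.coeFn_toLp] with x h1 h3 h4 h5
  rw [h1, h3, ← h4]
  exact h5

theorem coeFn_comp_reflect {f : L2} (hf : f ∈ EvenL2) : ∀ᵐ x, f (reflect x) = f x := by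
  have h := coeFn_reflectL2 f
  rw [(mem_evenL2_iff f).mp hf] at h
  filter_upwards [h] with x hx
  exact hx.symm

theorem symbol_reflect (ξ : Plane) : symbol (reflect ξ) = symbol ξ := by
  rw [symbol, symbol, reflect.norm_map]

/-! ### The Fourier transform preserves radial functions -/

/-- Gaussians are mapped to multiples of Gaussians; totality, continuity and closedness extend this
to all radial functions. -/
theorem fourierInv_mem_radialSubmodule {f : L2} (hf : f ∈ radialSubmodule) :
    (𝓕⁻ f : L2) ∈ radialSubmodule := by
  have hcl : f ∈ closure (Submodule.span ℂ (gaussians 0) : Set L2) := by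
    have := radialSubmodule_le 0 hf
    rwa [← SetLike.mem_coe, Submodule.topologicalClosure_coe] at this
  rw [← SetLike.mem_coe, ← isClosed_radialSubmodule.closure_eq]
  refine map_mem_closure (f := (FourierTransform.fourierInvCLM ℂ L2 : L2 → L2))
    (FourierTransform.fourierInvCLM ℂ L2).continuous hcl fun g hg => ?_
  have : Submodule.span ℂ (gaussians 0) ≤
      radialSubmodule.comap (FourierTransform.fourierInvCLM ℂ L2).toLinearMap := by
    rw [Submodule.span_le]
    rintro _ ⟨p, hp, -, rfl⟩
    change (𝓕⁻ (gaussian p hp) : L2) ∈ radialSubmodule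
    rw [fourierInv_gaussian]
    exact Submodule.smul_mem _ _ (gaussian_mem_radialSubmodule _)
  exact this hg

/-! ### Evaluation of the elements of `H⁻ˢ(ℝ²)` -/

theorem NegSobolev.norm_apply_le {s : ℕ} (f : NegSobolev s) (φ : 𝓢(Plane, ℂ)) :
    ‖f.toDistribution φ‖ ≤ ‖f‖ * sobolevNorm s φ := by
  -- A test function of norm 0 cannot be normalised; there the boundedness of `f` forces the value
  -- 0.
  rcases (sobolevNorm_nonneg s φ).eq_or_lt with h0 | hpos
  · obtain ⟨C, hC⟩ := f.2
    have := hC φ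
    rw [← h0, mul_zero] at this ⊢
    exact this
  · set c : ℂ := (((sobolevNorm s φ)⁻¹ : ℝ) : ℂ) with hc
    have hcn : ‖c‖ = (sobolevNorm s φ)⁻¹ := by
      rw [hc, Complex.norm_real, Real.norm_of_nonneg (inv_nonneg.mpr hpos.le)]
    have hball : sobolevNorm s (c • φ) ≤ 1 := by
      rw [sobolevNorm_smul, hcn, inv_mul_cancel₀ hpos.ne']
    have hle : ‖f.toDistribution (c • φ)‖ ≤ ‖f‖ :=
      le_ciSup (NegSobolev.bddAbove f) ⟨c • φ, hball⟩
    rw [map_smul, norm_smul, hcn, inv_mul_le_iff₀ hpos] at hle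
    linarith

/-- Evaluation at a test function, as a continuous linear functional on `H⁻ˢ(ℝ²)`. -/
def NegSobolev.eval {s : ℕ} (φ : 𝓢(Plane, ℂ)) : NegSobolev s →L[ℂ] ℂ :=
  LinearMap.mkContinuous
    { toFun := fun f => f.toDistribution φ
      map_add' := fun f g => by simp
      map_smul' := fun c f => by simp } (sobolevNorm s φ)
    (fun f => (f.norm_apply_le φ).trans_eq (mul_comm _ _))

theorem NegSobolev.hasDerivAt_apply {s : ℕ} {V : ℝ → NegSobolev s} {V' : NegSobolev s} {t : ℝ}
    (h : HasDerivAt V V' t) (φ : 𝓢(Plane, ℂ)) :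
    HasDerivAt (fun r => (V r).toDistribution φ) (V'.toDistribution φ) t :=
  ((NegSobolev.eval φ).restrictScalars ℝ).hasFDerivAt.comp_hasDerivAt t h

theorem absolutelyContinuousOnInterval_comp {X Y : Type*} [PseudoMetricSpace X]
    [PseudoMetricSpace Y] {K : ℝ≥0} {L : X → Y} (hL : LipschitzWith K L) {V : ℝ → X} {a b : ℝ}
    (hV : AbsolutelyContinuousOnInterval V a b) :
    AbsolutelyContinuousOnInterval (fun t => L (V t)) a b := by
  unfold AbsolutelyContinuousOnInterval at hV ⊢
  have h := hV.const_mul (K : ℝ)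
  rw [mul_zero] at h
  refine squeeze_zero (fun E => Finset.sum_nonneg fun _ _ => dist_nonneg) (fun E => ?_) h
  rw [Finset.mul_sum]
  exact Finset.sum_le_sum fun i _ => hL.dist_le_mul _ _

/-! ### Uniqueness of solutions -/

theorem ae_Icc_of_ae_restrict_Ioo {T : ℝ} (hT : 0 ≤ T) {p : ℝ → Prop}
    (h : ∀ᵐ t ∂(volume.restrict (Ioo 0 T)), p t) : ∀ᵐ t, t ∈ uIcc 0 T → t ∈ Ioo 0 T ∧ p t := by
  rw [uIcc_of_le hT, ← ae_restrict_iff' measurableSet_Icc,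
    ← Measure.restrict_congr_set Ioo_ae_eq_Icc]
  filter_upwards [h, ae_restrict_mem measurableSet_Ioo] with t h1 h2 using ⟨h2, h1⟩

/-- The integral of the bounded function `a` is Lipschitz, so its difference from `z` is absolutely
continuous with derivative zero almost everywhere, hence constant. -/
theorem eq_integral_of_ae_hasDerivAt {T : ℝ} (hT : 0 < T) {z a : ℝ → ℂ}
    (hz : AbsolutelyContinuousOnInterval z 0 T) (ha : ContinuousOn a (Icc 0 T))
    (h0 : z 0 = 0) (hd : ∀ᵐ t ∂(volume.restrict (Ioo 0 T)), HasDerivAt z (a t) t) :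
    ∀ t ∈ Icc 0 T, z t = ∫ s in 0..t, a s := by
  obtain ⟨C, hC⟩ := isCompact_Icc.exists_bound_of_continuousOn ha
  have hint {r s : ℝ} (hr : r ∈ Icc 0 T) (hs : s ∈ Icc 0 T) : IntervalIntegrable a volume r s :=
    (ha.mono (uIcc_subset_Icc hr hs)).intervalIntegrable
  have h00 : (0 : ℝ) ∈ Icc 0 T := ⟨le_rfl, hT.le⟩
  have hLip : LipschitzOnWith (Real.toNNReal C) (fun t => ∫ s in 0..t, a s) (uIcc 0 T) := by
    refine LipschitzOnWith.of_dist_le_mul fun r hr s hs => ?_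
    rw [uIcc_of_le hT.le] at hr hs
    rw [dist_eq_norm, intervalIntegral.integral_interval_sub_left (hint h00 hr) (hint h00 hs),
      Real.dist_eq]
    refine intervalIntegral.norm_integral_le_of_norm_le_const fun x hx => ?_
    refine (hC x (uIcc_subset_Icc hs hr (uIoc_subset_uIcc hx))).trans (Real.le_coe_toNNReal C)
  obtain ⟨c, hc⟩ := (hz.sub hLip.absolutelyContinuousOnInterval).const_of_ae_hasDerivAt_zero (by
    filter_upwards [ae_Icc_of_ae_restrict_Ioo hT.le hd] with t ht hmem
    obtain ⟨ht1, ht2⟩ := ht hmem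
    have hI := intervalIntegral.integral_hasDerivAt_right (hint h00 (Ioo_subset_Icc_self ht1))
      (ContinuousOn.stronglyMeasurableAtFilter isOpen_Ioo (ha.mono Ioo_subset_Icc_self) t ht1)
      (ha.continuousAt (Icc_mem_nhds ht1.1 ht1.2))
    simpa using ht2.sub hI)
  rw [uIcc_of_le hT.le] at hc
  intro t ht
  have h1 := hc 0 h00
  have h2 := hc t ht
  simp only [Pi.sub_apply, intervalIntegral.integral_same, sub_zero, h0] at h1 h2
  rw [← h1] at h2
  exact sub_eq_zero.mp h2

/-- The (inverse) Fourier transform of the test function `φ` vanishes outside the ball with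
radius `R`. -/
def BandLimited (R : ℝ) (φ : 𝓢(Plane, ℂ)) : Prop := ∀ ξ, R < ‖ξ‖ → 𝓕⁻ φ ξ = 0

theorem norm_toLp_fourierInv (φ : 𝓢(Plane, ℂ)) :
    ‖(𝓕⁻ φ).toLp 2 (volume : Measure Plane)‖ = ‖φ.toLp 2 (volume : Measure Plane)‖ := by
  conv_rhs => rw [← FourierTransform.fourier_fourierInv_eq (E := 𝓢(Plane, ℂ))
    (F := 𝓢(Plane, ℂ)) φ]
  exact (SchwartzMap.norm_fourier_toL2_eq _).symm

theorem norm_toLp_le_of_fourierInv {c : ℝ} {φ ψ : 𝓢(Plane, ℂ)}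
    (h : ∀ ξ, ‖𝓕⁻ ψ ξ‖ ≤ c * ‖𝓕⁻ φ ξ‖) :
    ‖ψ.toLp 2 (volume : Measure Plane)‖ ≤ c * ‖φ.toLp 2 (volume : Measure Plane)‖ := by
  rw [← norm_toLp_fourierInv, ← norm_toLp_fourierInv φ]
  refine Lp.norm_le_mul_norm_of_ae_le_mul ?_
  filter_upwards [(𝓕⁻ ψ).coeFn_toLp 2 volume, (𝓕⁻ φ).coeFn_toLp 2 volume] with ξ h1 h2
  rw [h1, h2]
  exact h ξ

theorem norm_fourierInv_lineDeriv (φ : 𝓢(Plane, ℂ)) (v ξ : Plane) :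
    ‖𝓕⁻ (∂_{v} φ) ξ‖ = 2 * Real.pi * |inner ℝ ξ v| * ‖𝓕⁻ φ ξ‖ := by
  rw [SchwartzMap.fourierInv_lineDerivOp_eq, smul_apply,
    SchwartzMap.smulLeftCLM_apply_apply (by fun_prop), norm_smul, norm_smul, norm_neg]
  simp [abs_of_pos Real.pi_pos, mul_assoc]

theorem BandLimited.norm_lineDeriv_le {R : ℝ} {φ : 𝓢(Plane, ℂ)} (h : BandLimited R φ) {v : Plane}
    (hv : ‖v‖ = 1) (ξ : Plane) : ‖𝓕⁻ (∂_{v} φ) ξ‖ ≤ 2 * Real.pi * R * ‖𝓕⁻ φ ξ‖ := by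
  rw [norm_fourierInv_lineDeriv]
  rcases lt_or_ge R ‖ξ‖ with hR | hR
  · rw [h ξ hR]
    simp
  · have : |inner ℝ ξ v| ≤ R := by
      have := abs_real_inner_le_norm ξ v
      rw [hv, mul_one] at this
      exact this.trans hR
    have := Real.pi_pos
    gcongr

theorem BandLimited.lineDeriv {R : ℝ} {φ : 𝓢(Plane, ℂ)} (h : BandLimited R φ) (v : Plane) :
    BandLimited R (∂_{v} φ) := by
  intro ξ hξ
  have := norm_fourierInv_lineDeriv φ v ξ
  rw [h ξ hξ, norm_zero, mul_zero] at this
  exact norm_eq_zero.mp this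

theorem BandLimited.iterate {R A : ℝ} (hA : 2 * Real.pi * R ≤ A) (hA0 : 0 ≤ A) {v : Plane}
    (hv : ‖v‖ = 1) {φ : 𝓢(Plane, ℂ)} (h : BandLimited R φ) (n : ℕ) :
    BandLimited R ((LineDeriv.lineDerivOpCLM ℂ 𝓢(Plane, ℂ) v ^ n) φ) ∧
      ∀ ξ, ‖𝓕⁻ ((LineDeriv.lineDerivOpCLM ℂ 𝓢(Plane, ℂ) v ^ n) φ) ξ‖ ≤ A ^ n * ‖𝓕⁻ φ ξ‖ := by
  induction n with
  | zero => exact ⟨h, fun ξ => by simp⟩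
  | succ n ih =>
    have e : (LineDeriv.lineDerivOpCLM ℂ 𝓢(Plane, ℂ) v ^ (n + 1)) φ =
        ∂_{v} ((LineDeriv.lineDerivOpCLM ℂ 𝓢(Plane, ℂ) v ^ n) φ) := by
      rw [pow_succ']
      rfl
    rw [e]
    refine ⟨ih.1.lineDeriv v, fun ξ => ?_⟩
    calc _ ≤ 2 * Real.pi * R * _ := ih.1.norm_lineDeriv_le hv ξ
      _ ≤ A * (A ^ n * ‖𝓕⁻ φ ξ‖) :=
        mul_le_mul hA (ih.2 ξ) (norm_nonneg _) hA0
      _ = A ^ (n + 1) * ‖𝓕⁻ φ ξ‖ := by ring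

/-- Each derivative along a unit vector costs at most a factor `2πR` on the Fourier side. -/
theorem BandLimited.exists_sobolevNorm_le (s : ℕ) (R : ℝ) :
    ∃ K, ∀ φ, BandLimited R φ → sobolevNorm s φ ≤ K * ‖φ.toLp 2 (volume : Measure Plane)‖ := by
  -- The maximum with 1 keeps `A` nonnegative even if `R` is negative.
  set A := max 1 (2 * Real.pi * R)
  have hA1 : 1 ≤ A := le_max_left _ _
  have hA0 : 0 ≤ A := zero_le_one.trans hA1
  have hA : 2 * Real.pi * R ≤ A := le_max_right _ _
  set C : ℝ := ∑ k ∈ Finset.range (s + 1), ∑ α ∈ Finset.HasAntidiagonal.antidiagonal k,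
    ((s.factorial : ℝ) / ((s - k).factorial * α.1.factorial * α.2.factorial)) * (A ^ k) ^ 2 with hC
  refine ⟨√C, fun φ hφ => ?_⟩
  rw [sobolevNorm, ← Real.sqrt_sq (norm_nonneg (φ.toLp 2 (volume : Measure Plane))),
    ← Real.sqrt_mul' _ (sq_nonneg _)]
  refine Real.sqrt_le_sqrt ?_
  simp only [hC, Finset.sum_mul]
  refine Finset.sum_le_sum fun k _ => Finset.sum_le_sum fun α hα => ?_
  rw [mul_assoc _ ((A ^ k) ^ 2), ← mul_pow]
  have hb : ‖(partialDeriv α φ).toLp 2 (volume : Measure Plane)‖ ≤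
      A ^ k * ‖φ.toLp 2 (volume : Measure Plane)‖ := by
    refine norm_toLp_le_of_fourierInv fun ξ => ?_
    obtain ⟨h1, h2⟩ := hφ.iterate hA hA0 (v := EuclideanSpace.single (1 : Fin 2) (1 : ℝ))
      (by simp) α.2
    obtain ⟨-, h4⟩ := h1.iterate hA hA0 (v := EuclideanSpace.single (0 : Fin 2) (1 : ℝ))
      (by simp) α.1
    refine (h4 ξ).trans ?_
    rw [← Finset.HasAntidiagonal.mem_antidiagonal.mp hα, pow_add, mul_assoc]
    exact mul_le_mul_of_nonneg_left (h2 ξ) (by positivity)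
  gcongr

theorem BandLimited.laplacian {R : ℝ} {φ : 𝓢(Plane, ℂ)} (h : BandLimited R φ) :
    BandLimited R (Δ φ) := by
  intro ξ hξ
  rw [fourierInv_laplacian, h ξ hξ, mul_zero]

theorem BandLimited.norm_laplacian_le {R : ℝ} {φ : 𝓢(Plane, ℂ)} (h : BandLimited R φ) :
    ‖(Δ φ).toLp 2 (volume : Measure Plane)‖ ≤
      (2 * Real.pi) ^ 2 * R ^ 2 * ‖φ.toLp 2 (volume : Measure Plane)‖ := by
  refine norm_toLp_le_of_fourierInv fun ξ => ?_
  rw [fourierInv_laplacian, norm_mul, norm_neg, Complex.norm_real,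
    Real.norm_of_nonneg (symbol_nonneg ξ), symbol]
  rcases lt_or_ge R ‖ξ‖ with hR | hR
  · rw [h ξ hR]
    simp
  · gcongr

/-- Testing `𝓕 f` against a compactly supported `g` is testing `f` against `𝓕 g`, which is
band-limited. -/
theorem eq_zero_of_bandLimited {f : L2}
    (h : ∀ R φ, BandLimited R φ → (f : 𝓢'(Plane, ℂ)) φ = 0) : f = 0 := by
  have hz : (𝓕 f : L2) = 0 := by
    rw [Lp.eq_zero_iff_ae_eq_zero]
    refine ae_eq_zero_of_integral_contDiff_smul_eq_zero
      ((Lp.memLp _).locallyIntegrable one_le_two) fun g hg hgc => ?_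
    have hg₁ : HasCompactSupport (Complex.ofRealCLM ∘ g) := hgc.comp_left rfl
    have hg₂ : ContDiff ℝ (↑(⊤ : ℕ∞)) (Complex.ofRealCLM ∘ g) := by fun_prop
    set φ : 𝓢(Plane, ℂ) := hg₁.toSchwartzMap hg₂ with hφ
    obtain ⟨R, hR⟩ := hgc.isCompact.isBounded.subset_closedBall 0
    have hb : BandLimited R (𝓕 φ) := by
      intro ξ hξ
      rw [FourierTransform.fourierInv_fourier_eq]
      change Complex.ofReal (g ξ) = 0
      rw [image_eq_zero_of_notMem_tsupport (f := g), Complex.ofReal_zero]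
      intro hmem
      have := hR hmem
      rw [mem_closedBall_zero_iff] at this
      linarith
    have := h R _ hb
    rw [← toDistribution_fourier, toDistribution_apply] at this
    exact this
  rw [← FourierTransform.fourierInv_fourier_eq (E := L2) (F := L2) f, hz]
  exact map_zero (FourierTransform.fourierInvCLM ℂ L2)

/-- The pairing with `φ` at time `t` is the integral over `[0, t]` of the pairing with `Δ φ`. For
`φ` with band `R`, `Δ` keeps the band and has norm at most `D = (2πR)²`, so `n` iterations give a
factor `(D t)ⁿ / n!`, which tends to 0. -/
theorem eq_zero_of_heat_equation {T : ℝ} (hT : 0 < T) {Z : ℝ → NegSobolev 2} {z : ℝ → L2}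
    (hZz : ∀ t ∈ Icc 0 T, (Z t).toDistribution = (z t : 𝓢'(Plane, ℂ)))
    (hac : AbsolutelyContinuousOnInterval Z 0 T) (h0 : Z 0 = 0)
    (hd : ∀ᵐ t ∂(volume.restrict (Ioo 0 T)), ∃ V' : NegSobolev 2, HasDerivAt Z V' t ∧
      V'.toDistribution = Δ (z t : 𝓢'(Plane, ℂ))) :
    ∀ t ∈ Icc 0 T, z t = 0 := by
  have hcont (φ : 𝓢(Plane, ℂ)) :
      AbsolutelyContinuousOnInterval (fun t => (Z t).toDistribution φ) 0 T :=
    absolutelyContinuousOnInterval_comp (NegSobolev.eval φ).lipschitz hac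
  have hint (φ : 𝓢(Plane, ℂ)) (t : ℝ) (ht : t ∈ Icc 0 T) :
      (Z t).toDistribution φ = ∫ s in 0..t, (Z s).toDistribution (Δ φ) := by
    refine eq_integral_of_ae_hasDerivAt hT (hcont φ) ?_ (by simp [h0]) ?_ t ht
    · have := (hcont (Δ φ)).continuousOn
      rwa [uIcc_of_le hT.le] at this
    · filter_upwards [hd, ae_restrict_mem measurableSet_Ioo] with t ⟨V', hV', he⟩ hmem
      have := NegSobolev.hasDerivAt_apply hV' φ
      rw [he, TemperedDistribution.laplacian_apply_apply, ← hZz t (Ioo_subset_Icc_self hmem)] at this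
      exact this
  obtain ⟨M, hM⟩ := hac.exists_bound
  rw [uIcc_of_le hT.le] at hM
  have hM0 : 0 ≤ M := (norm_nonneg _).trans (hM 0 ⟨le_rfl, hT.le⟩)
  intro t ht
  refine eq_zero_of_bandLimited fun R φ hφ => ?_
  obtain ⟨K, hK⟩ := BandLimited.exists_sobolevNorm_le 2 R
  set D := (2 * Real.pi) ^ 2 * R ^ 2
  have hD : 0 ≤ D := by positivity
  have key (n : ℕ) : ∀ φ, BandLimited R φ → ∀ t ∈ Icc 0 T, ‖(Z t).toDistribution φ‖ ≤
      M * (|K| * ‖φ.toLp 2 (volume : Measure Plane)‖) * ((D * t) ^ n / n.factorial) := by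
    induction n with
    | zero =>
      intro φ hφ t ht
      rw [pow_zero, Nat.factorial_zero, Nat.cast_one, div_one, mul_one]
      refine ((Z t).norm_apply_le φ).trans (mul_le_mul (hM t ht) ((hK φ hφ).trans ?_)
        (sobolevNorm_nonneg _ _) hM0)
      exact mul_le_mul_of_nonneg_right (le_abs_self K) (norm_nonneg _)
    | succ n ih =>
      intro φ hφ t ht
      rw [hint φ t ht]
      have hb : ∀ s ∈ Ioc 0 t, ‖(Z s).toDistribution (Δ φ)‖ ≤
          M * (|K| * (D * ‖φ.toLp 2 (volume : Measure Plane)‖)) * (D ^ n / n.factorial) * s ^ n := by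
        intro s hs
        refine (ih _ hφ.laplacian s ⟨hs.1.le, hs.2.trans ht.2⟩).trans ?_
        have hs0 := hs.1.le
        have := hφ.norm_laplacian_le
        rw [mul_assoc (M * (|K| * (D * _))), mul_pow, mul_div_right_comm]
        gcongr
      refine (intervalIntegral.norm_integral_le_of_norm_le ht.1
        (Eventually.of_forall hb)
        (Continuous.intervalIntegrable (by fun_prop) _ _)).trans_eq ?_
      rw [intervalIntegral.integral_const_mul, integral_pow, Nat.factorial_succ]
      push_cast
      have : (n.factorial : ℝ) ≠ 0 := by positivity
      field_simp
      ring
  have hlim := (FloorSemiring.tendsto_pow_div_factorial_atTop (D * t)).const_mul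
    (M * (|K| * ‖φ.toLp 2 (volume : Measure Plane)‖))
  rw [mul_zero] at hlim
  have := ge_of_tendsto' hlim fun n => key n φ hφ t ht
  rw [← hZz t ht]
  exact norm_le_zero_iff.mp this

theorem IsSolution.eqOn {T : ℝ} (hT : 0 < T) {u : ℝ → ℂ} {W₀ : EvenL2} {W W' : ℝ → EvenL2}
    (h : IsSolution T u W₀ W) (h' : IsSolution T u W₀ W') : EqOn W' W (Icc 0 T) := by
  obtain ⟨V, hV, hac, hd⟩ := h.equation
  obtain ⟨V', hV', hac', hd'⟩ := h'.equation
  have hsub (f g : L2) : ((f - g : L2) : 𝓢'(Plane, ℂ)) = (f : 𝓢'(Plane, ℂ)) - (g : 𝓢'(Plane, ℂ)) :=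
    map_sub (Lp.toTemperedDistributionCLM ℂ volume 2) f g
  have hz := eq_zero_of_heat_equation hT (Z := V' - V) (z := fun t => (W' t : L2) - (W t : L2))
    (fun t ht => by
      rw [hsub, ← hV t ht, ← hV' t ht, Pi.sub_apply, map_sub]) (hac'.sub hac)
    (NegSobolev.toDistribution_injective (by
      have h0 : (0 : ℝ) ∈ Icc 0 T := ⟨le_rfl, hT.le⟩
      rw [Pi.sub_apply, map_sub, hV 0 h0, hV' 0 h0, h.initial, h'.initial, sub_self, map_zero]))
    (by
      filter_upwards [hd, hd'] with t h₁ h₂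
      obtain ⟨D, hD, -, hDe⟩ := h₁
      obtain ⟨D', hD', -, hDe'⟩ := h₂
      refine ⟨D' - D, hD'.sub hD, ?_⟩
      rw [map_sub, hDe, hDe', hsub, sub_sub_sub_cancel_right]
      exact (map_sub (LineDeriv.laplacianCLM ℝ Plane 𝓢'(Plane, ℂ)) _ _).symm)
  intro t ht
  exact Subtype.ext (sub_eq_zero.mp (hz t ht))

/-! ### The Duhamel integral -/

/-- `∫₀ᵗ exp (-lam (t - s)) v(s) ds`. -/
def duhamel (v : ℝ → ℂ) (lam t : ℝ) : ℂ :=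
  ∫ s in 0..t, (Real.exp (-lam * (t - s)) : ℂ) * v s

section Duhamel

variable {v : ℝ → ℂ} {M : ℝ} {lam : ℝ}

theorem locallyIntegrable_of_bound (hv : Measurable v) (hM : ∀ t, ‖v t‖ ≤ M) :
    LocallyIntegrable v volume :=
  (memLp_top_of_bound hv.aestronglyMeasurable M (Eventually.of_forall hM)).locallyIntegrable le_top

theorem intervalIntegrable_mul (hv : Measurable v) (hM : ∀ t, ‖v t‖ ≤ M) {c : ℝ → ℂ}
    (hc : Continuous c) (a b : ℝ) : IntervalIntegrable (fun s => c s * v s) volume a b := by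
  refine IntervalIntegrable.continuousOn_mul ?_ hc.continuousOn
  exact intervalIntegrable_iff.mpr (((locallyIntegrable_of_bound hv hM).integrableOn_isCompact
    isCompact_uIcc).mono_set uIoc_subset_uIcc)

theorem norm_integral_exp_mul_le (hM : ∀ t, ‖v t‖ ≤ M) (hlam : 0 ≤ lam) {a b : ℝ} (hab : a ≤ b) :
    ‖∫ s in a..b, (Real.exp (-lam * (b - s)) : ℂ) * v s‖ ≤ M * (b - a) := by
  have hM0 : 0 ≤ M := (norm_nonneg _).trans (hM 0)
  have h := intervalIntegral.norm_integral_le_of_norm_le_const (a := a) (b := b) (C := M)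
    (f := fun s => (Real.exp (-lam * (b - s)) : ℂ) * v s) fun s hs => by
      rw [uIoc_of_le hab] at hs
      rw [norm_mul, Complex.norm_real, Real.norm_of_nonneg (Real.exp_nonneg _), ← one_mul M]
      refine mul_le_mul (Real.exp_le_one_iff.mpr ?_) (hM s) (norm_nonneg _) zero_le_one
      nlinarith [hs.2]
  rwa [abs_of_nonneg (sub_nonneg.mpr hab)] at h

theorem norm_duhamel_le (hM : ∀ t, ‖v t‖ ≤ M) (hlam : 0 ≤ lam) {t : ℝ} (ht : 0 ≤ t) :
    ‖duhamel v lam t‖ ≤ M * t :=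
  (norm_integral_exp_mul_le hM hlam ht).trans_eq (by rw [sub_zero])

/-- The kernel has mass `(1 - exp (-lam t)) / lam` for `lam > 0`. This decay of order `1 / lam` is
what makes the control term square integrable. -/
theorem mul_norm_duhamel_le (hM : ∀ t, ‖v t‖ ≤ M) (hlam : 0 ≤ lam) {t : ℝ} (ht : 0 ≤ t) :
    lam * ‖duhamel v lam t‖ ≤ M := by
  have hM0 : 0 ≤ M := (norm_nonneg _).trans (hM 0)
  have hF : ∫ s in 0..t, lam * Real.exp (-lam * (t - s)) = 1 - Real.exp (-lam * t) := by
    rw [intervalIntegral.integral_eq_sub_of_hasDerivAt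
      (f := fun s => Real.exp (-lam * (t - s))) (fun s _ => ?_)
      (Continuous.intervalIntegrable (by fun_prop) _ _)]
    · simp
    · have h := (((hasDerivAt_id s).const_sub t).const_mul (-lam)).exp
      refine h.congr_deriv ?_
      simp only [id]
      ring
  have h := intervalIntegral.norm_integral_le_of_norm_le (μ := volume) ht
    (f := fun s => (Real.exp (-lam * (t - s)) : ℂ) * v s)
    (g := fun s => M * Real.exp (-lam * (t - s)))
    (Eventually.of_forall fun s _ => by
      rw [norm_mul, Complex.norm_real, Real.norm_of_nonneg (Real.exp_nonneg _), mul_comm]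
      exact mul_le_mul_of_nonneg_right (hM s) (Real.exp_nonneg _))
    (Continuous.intervalIntegrable (by fun_prop) _ _)
  calc lam * ‖duhamel v lam t‖ ≤ lam * ∫ s in 0..t, M * Real.exp (-lam * (t - s)) :=
        mul_le_mul_of_nonneg_left h hlam
    _ = M * (1 - Real.exp (-lam * t)) := by
        rw [← hF, ← intervalIntegral.integral_const_mul, ← intervalIntegral.integral_const_mul]
        congr 1
        ext s
        ring
    _ ≤ M := by
        have := Real.exp_nonneg (-lam * t)
        nlinarith

theorem duhamel_add (hv : Measurable v) (hM : ∀ t, ‖v t‖ ≤ M) (lam r t : ℝ) :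
    duhamel v lam t = (Real.exp (-lam * (t - r)) : ℂ) * duhamel v lam r +
      ∫ s in r..t, (Real.exp (-lam * (t - s)) : ℂ) * v s := by
  rw [duhamel, duhamel, ← intervalIntegral.integral_const_mul,
    ← intervalIntegral.integral_add_adjacent_intervals (b := r)
      (intervalIntegrable_mul hv hM (by fun_prop) _ _)
      (intervalIntegrable_mul hv hM (by fun_prop) _ _)]
  congr 2
  ext s
  rw [← mul_assoc, ← Complex.ofReal_mul, ← Real.exp_add]
  congr 3
  ring

theorem abs_exp_sub_exp_le (hlam : 0 ≤ lam) {r t : ℝ} (hr : 0 ≤ r) (ht : 0 ≤ t) :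
    |Real.exp (-r * lam) - Real.exp (-t * lam)| ≤ lam * |r - t| := by
  wlog h : r ≤ t generalizing r t
  · rw [abs_sub_comm, abs_sub_comm r]
    exact this ht hr (le_of_not_ge h)
  have h1 : Real.exp (-t * lam) = Real.exp (-r * lam) * Real.exp (-((t - r) * lam)) := by
    rw [← Real.exp_add]
    congr 1
    ring
  have h2 : Real.exp (-r * lam) ≤ 1 := Real.exp_le_one_iff.mpr (by nlinarith)
  have h3 : Real.exp (-((t - r) * lam)) ≤ 1 := Real.exp_le_one_iff.mpr (by nlinarith)
  have h4 := Real.add_one_le_exp (-((t - r) * lam))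
  have h5 := Real.exp_nonneg (-r * lam)
  rw [abs_sub_comm r, abs_of_nonneg (sub_nonneg.mpr h), h1, abs_of_nonneg (by nlinarith)]
  nlinarith

/-- The integral over the added time contributes `M |r - t|`, and so does the damping of the earlier
part by `mul_norm_duhamel_le`; the bound is uniform in `lam`. -/
theorem norm_duhamel_sub_le (hv : Measurable v) (hM : ∀ t, ‖v t‖ ≤ M) (hlam : 0 ≤ lam) {r t : ℝ}
    (hr : 0 ≤ r) (ht : 0 ≤ t) : ‖duhamel v lam r - duhamel v lam t‖ ≤ 2 * M * |r - t| := by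
  wlog h : r ≤ t generalizing r t
  · rw [norm_sub_rev, abs_sub_comm]
    exact this ht hr (le_of_not_ge h)
  have h1 := norm_integral_exp_mul_le hM hlam h
  have h2 := mul_norm_duhamel_le hM hlam hr
  have h3 : |1 - Real.exp (-lam * (t - r))| ≤ lam * (t - r) := by
    have := abs_exp_sub_exp_le hlam le_rfl (sub_nonneg.mpr h)
    rw [neg_zero, zero_mul, Real.exp_zero, zero_sub, abs_neg, abs_of_nonneg (sub_nonneg.mpr h)]
      at this
    rwa [neg_mul, mul_comm, ← neg_mul] at this
  have e : duhamel v lam r - duhamel v lam t =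
      ((1 - Real.exp (-lam * (t - r)) : ℝ) : ℂ) * duhamel v lam r -
        ∫ s in r..t, (Real.exp (-lam * (t - s)) : ℂ) * v s := by
    rw [duhamel_add hv hM lam r t]
    push_cast
    ring
  rw [e, abs_sub_comm, abs_of_nonneg (sub_nonneg.mpr h)]
  refine (norm_sub_le _ _).trans ?_
  rw [norm_mul, Complex.norm_real, Real.norm_eq_abs]
  have h4 : |1 - Real.exp (-lam * (t - r))| * ‖duhamel v lam r‖ ≤
      lam * (t - r) * ‖duhamel v lam r‖ := mul_le_mul_of_nonneg_right h3 (norm_nonneg _)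
  nlinarith [sub_nonneg.mpr h]

theorem hasDerivAt_duhamel (hv : Measurable v) (hM : ∀ t, ‖v t‖ ≤ M) (lam : ℝ) {t : ℝ}
    (hd : HasDerivAt (fun r => ∫ s in 0..r, v s) (v t) t) :
    HasDerivAt (duhamel v lam) (v t - lam * duhamel v lam t) t := by
  -- The function `v` may be discontinuous at `t`. Splitting `exp (lam s) v(s)` into `exp (lam t)
  -- v(s) + k(s)` leaves one term covered by `hd` and one continuous at `t`, since `k` vanishes
  -- there and `v` is bounded.
  set k : ℝ → ℂ := fun s => ((Real.exp (lam * s) - Real.exp (lam * t) : ℝ) : ℂ) * v s with hk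
  have hk0 : k t = 0 := by simp [hk]
  have hkm : Measurable k := by fun_prop
  have hki (a b : ℝ) : IntervalIntegrable k volume a b :=
    intervalIntegrable_mul hv hM (by fun_prop) a b
  have hkc : ContinuousAt k t := by
    rw [ContinuousAt, hk0]
    have hc : Continuous fun s => |Real.exp (lam * s) - Real.exp (lam * t)| * M := by fun_prop
    have h0 := hc.tendsto t
    rw [sub_self, abs_zero, zero_mul] at h0
    refine squeeze_zero_norm (fun s => ?_) h0
    rw [norm_mul, Complex.norm_real, Real.norm_eq_abs]
    exact mul_le_mul_of_nonneg_left (hM s) (abs_nonneg _)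
  have hK := intervalIntegral.integral_hasDerivAt_right (hki 0 t)
    hkm.stronglyMeasurable.stronglyMeasurableAtFilter hkc
  rw [hk0] at hK
  have hE : (fun r => duhamel v lam r) = fun r => (Real.exp (-lam * r) : ℂ) *
      ((Real.exp (lam * t) : ℂ) * (∫ s in 0..r, v s) + ∫ s in 0..r, k s) := by
    ext r
    rw [duhamel, ← intervalIntegral.integral_const_mul, ← intervalIntegral.integral_add
      (intervalIntegrable_mul hv hM continuous_const _ _) (hki _ _),
      ← intervalIntegral.integral_const_mul]
    congr 1
    ext s
    rw [hk, ← add_mul, ← Complex.ofReal_add, add_sub_cancel, ← mul_assoc, ← Complex.ofReal_mul,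
      ← Real.exp_add]
    congr 3
    ring
  have hexp : HasDerivAt (fun r : ℝ => (Real.exp (-lam * r) : ℂ))
      ((Real.exp (-lam * t) * (-lam * 1) : ℝ) : ℂ) t :=
    (((hasDerivAt_id t).const_mul (-lam)).exp).ofReal_comp
  have h := hexp.mul ((hd.const_mul (Real.exp (lam * t) : ℂ)).add hK)
  have hEt := congrFun hE t
  change HasDerivAt (fun r => duhamel v lam r) _ t
  rw [hEt, hE]
  refine h.congr_deriv ?_
  have h1 : (Real.exp (-lam * t) : ℂ) * (Real.exp (lam * t) : ℂ) = 1 := by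
    rw [← Complex.ofReal_mul, ← Real.exp_add]
    simp
  simp only [Pi.add_apply, add_zero, Complex.ofReal_mul, Complex.ofReal_neg, Complex.ofReal_one]
  linear_combination v t * h1

theorem measurable_duhamel (hv : Measurable v) (t : ℝ) : Measurable fun lam => duhamel v lam t := by
  have hm : StronglyMeasurable (Function.uncurry fun (lam s : ℝ) =>
      (Real.exp (-lam * (t - s)) : ℂ) * v s) := by
    refine Measurable.stronglyMeasurable ?_
    unfold Function.uncurry
    fun_prop
  unfold duhamel intervalIntegral
  exact (hm.integral_prod_right.measurable).sub (hm.integral_prod_right.measurable)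

end Duhamel

/-! ### Square integrability of the symbols -/

/-- The function `(1 + λ)⁻¹`, where `λ` is the symbol of `-Δ`. -/
def resolvent (ξ : Plane) : ℝ := (1 + symbol ξ)⁻¹

theorem resolvent_pos (ξ : Plane) : 0 < resolvent ξ :=
  inv_pos.mpr (by linarith [symbol_nonneg ξ])

theorem resolvent_le_one (ξ : Plane) : resolvent ξ ≤ 1 :=
  inv_le_one_of_one_le₀ (by linarith [symbol_nonneg ξ])

theorem one_add_symbol_mul_resolvent (ξ : Plane) : (1 + symbol ξ) * resolvent ξ = 1 :=
  mul_inv_cancel₀ (by linarith [symbol_nonneg ξ])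

theorem symbol_mul_resolvent_le_one (ξ : Plane) : symbol ξ * resolvent ξ ≤ 1 := by
  have := one_add_symbol_mul_resolvent ξ
  have := resolvent_pos ξ
  linarith

theorem continuous_resolvent : Continuous resolvent :=
  (continuous_const.add continuous_symbol).inv₀ fun ξ =>
    (by linarith [symbol_nonneg ξ] : 0 < 1 + symbol ξ).ne'

/-- The square decays like `‖ξ‖⁻⁴`, which is integrable in dimension 2. -/
theorem memLp_resolvent : MemLp resolvent 2 volume := by
  rw [memLp_two_iff_integrable_sq continuous_resolvent.aestronglyMeasurable]
  have h := integrable_rpow_neg_one_add_norm_sq (E := Plane) (μ := volume) (r := 4)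
    (by simp; norm_num)
  refine h.mono' (continuous_resolvent.pow 2).aestronglyMeasurable
    (Eventually.of_forall fun ξ => ?_)
  rw [Real.norm_of_nonneg (sq_nonneg _), resolvent, inv_pow,
    show (-4 / 2 : ℝ) = -(2 : ℕ) by norm_num, Real.rpow_neg (by positivity), Real.rpow_natCast]
  have h1 : ‖ξ‖ ^ 2 ≤ symbol ξ := by
    rw [symbol]
    refine le_mul_of_one_le_left (sq_nonneg _) ?_
    nlinarith [Real.pi_gt_three]
  gcongr

theorem memLp_duhamel {v : ℝ → ℂ} {M : ℝ} (hv : Measurable v) (hM : ∀ t, ‖v t‖ ≤ M) {t : ℝ}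
    (ht : 0 ≤ t) : MemLp (fun ξ : Plane => duhamel v (symbol ξ) t) 2 volume := by
  refine memLp_resolvent.of_le_mul (c := M * t + M)
    ((measurable_duhamel hv t).comp continuous_symbol.measurable).aestronglyMeasurable
    (Eventually.of_forall fun ξ => ?_)
  have h1 := norm_duhamel_le hM (symbol_nonneg ξ) ht
  have h2 := mul_norm_duhamel_le hM (symbol_nonneg ξ) ht
  rw [Real.norm_of_nonneg (resolvent_pos ξ).le]
  calc ‖duhamel v (symbol ξ) t‖ = (1 + symbol ξ) * resolvent ξ * ‖duhamel v (symbol ξ) t‖ := by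
        rw [one_add_symbol_mul_resolvent, one_mul]
    _ = (‖duhamel v (symbol ξ) t‖ + symbol ξ * ‖duhamel v (symbol ξ) t‖) * resolvent ξ := by ring
    _ ≤ (M * t + M) * resolvent ξ :=
        mul_le_mul_of_nonneg_right (add_le_add h1 h2) (resolvent_pos ξ).le

/-! ### Differentiation in `L²(ℝ²)` -/

theorem norm_toLp_sq {g : Plane → ℂ} (hg : MemLp g 2 volume) :
    ‖hg.toLp g‖ ^ 2 = ∫ x, ‖g x‖ ^ 2 := by
  have h : inner ℂ (hg.toLp g) (hg.toLp g) = ((∫ x, ‖g x‖ ^ 2 : ℝ) : ℂ) := by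
    rw [L2.inner_def, ← integral_complex_ofReal]
    refine integral_congr_ae ?_
    filter_upwards [hg.coeFn_toLp] with x hx
    rw [hx, inner_self_eq_norm_sq_to_K]
    push_cast
    rfl
  rw [← inner_self_eq_norm_sq (𝕜 := ℂ), h]
  rfl

theorem tendsto_toLp_of_dominated {ι : Type*} {l : Filter ι} [l.IsCountablyGenerated]
    {F : ι → Plane → ℂ} {f : Plane → ℂ} {b : Plane → ℝ} (hF : ∀ i, MemLp (F i) 2 volume)
    (hf : MemLp f 2 volume) (hb : MemLp b 2 volume)
    (hbound : ∀ᶠ i in l, ∀ᵐ x, ‖F i x - f x‖ ≤ b x)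
    (hlim : ∀ᵐ x, Tendsto (fun i => F i x) l (𝓝 (f x))) :
    Tendsto (fun i => (hF i).toLp (F i)) l (𝓝 (hf.toLp f)) := by
  have h : Tendsto (fun i => ∫ x, ‖F i x - f x‖ ^ 2) l (𝓝 (∫ _ : Plane, (0 : ℝ))) := by
    refine tendsto_integral_filter_of_dominated_convergence (fun x => b x ^ 2)
      (Eventually.of_forall fun i => (((hF i).1.sub hf.1).norm.pow 2)) ?_ hb.integrable_sq ?_
    · filter_upwards [hbound] with i hi
      filter_upwards [hi] with x hx
      rw [Real.norm_of_nonneg (sq_nonneg _)]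
      exact pow_le_pow_left₀ (norm_nonneg _) hx 2
    · filter_upwards [hlim] with x hx
      have := ((hx.sub_const (f x)).norm).pow 2
      simpa using this
  rw [integral_zero] at h
  rw [tendsto_iff_norm_sub_tendsto_zero]
  have h2 := h.sqrt
  rw [Real.sqrt_zero] at h2
  refine h2.congr fun i => ?_
  rw [← MemLp.toLp_sub (hF i) hf, ← Real.sqrt_sq (norm_nonneg (((hF i).sub hf).toLp _)),
    norm_toLp_sq]
  rfl

/-- The Lipschitz bound dominates the difference quotients by `b`, so pointwise convergence becomes
convergence in `L²`. -/
theorem hasDerivAt_toLp {q : ℝ → Plane → ℂ} {q' : Plane → ℂ} {b : Plane → ℝ} {t : ℝ}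
    (hq : ∀ s, MemLp (q s) 2 volume) (hq' : MemLp q' 2 volume) (hb : MemLp b 2 volume)
    (hbound : ∀ s, ∀ᵐ x, ‖q s x - q t x‖ ≤ b x * |s - t|)
    (hd : ∀ᵐ x, HasDerivAt (fun s => q s x) (q' x) t) :
    HasDerivAt (fun s => (hq s).toLp (q s)) (hq'.toLp q') t := by
  rw [hasDerivAt_iff_tendsto_slope]
  have hS (s : ℝ) : MemLp (fun x => slope (fun r => q r x) t s) 2 volume :=
    ((hq s).sub (hq t)).const_smul ((s - t)⁻¹)
  have h := tendsto_toLp_of_dominated (l := 𝓝[≠] t) hS hq' (hb.add hq'.norm) ?_ ?_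
  · refine h.congr fun s => ?_
    rw [slope_def_module, ← MemLp.toLp_sub (hq s) (hq t)]
    rfl
  · filter_upwards [self_mem_nhdsWithin] with s hs
    filter_upwards [hbound s] with x hx
    refine (norm_sub_le _ _).trans (add_le_add_left ?_ _)
    have hpos : 0 < |s - t| := abs_pos.mpr (sub_ne_zero.mpr hs)
    rw [slope_def_module, norm_smul, norm_inv, Real.norm_eq_abs, inv_mul_le_iff₀ hpos, mul_comm]
    exact hx
  · filter_upwards [hd] with x hx
    exact hasDerivAt_iff_tendsto_slope.mp hx

/-! ### The operator `1 - Δ` from `L²(ℝ²)` to `H⁻²(ℝ²)` -/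

theorem norm_toDistribution_le (f : L2) (φ : 𝓢(Plane, ℂ)) :
    ‖(f : 𝓢'(Plane, ℂ)) φ‖ ≤ ‖f‖ * ‖φ.toLp 2 (volume : Measure Plane)‖ := by
  have h : (f : 𝓢'(Plane, ℂ)) φ = inner ℂ (star (φ.toLp 2 (volume : Measure Plane))) f := by
    rw [toDistribution_apply, L2.inner_def]
    refine integral_congr_ae ?_
    filter_upwards [Lp.coeFn_star (φ.toLp 2 (volume : Measure Plane)),
      φ.coeFn_toLp 2 volume] with x hx hx'
    rw [hx, Pi.star_apply, hx', RCLike.inner_apply, mul_comm]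
    simp
  rw [h, mul_comm]
  refine (norm_inner_le_norm _ _).trans (mul_le_mul_of_nonneg_right ?_ (norm_nonneg f))
  refine Lp.norm_le_norm_of_ae_le ?_
  filter_upwards [Lp.coeFn_star (φ.toLp 2 (volume : Measure Plane))] with x hx
  rw [hx, Pi.star_apply, norm_star]

theorem norm_partialDeriv_le_sobolevNorm {s : ℕ} {α : ℕ × ℕ}
    (h1 : 1 ≤ (s.factorial : ℝ) / ((s - (α.1 + α.2)).factorial * α.1.factorial * α.2.factorial))
    (hα : α.1 + α.2 ≤ s) (φ : 𝓢(Plane, ℂ)) :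
    ‖(partialDeriv α φ).toLp 2 (volume : Measure Plane)‖ ≤ sobolevNorm s φ := by
  refine Real.le_sqrt_of_sq_le ?_
  have hk : α.1 + α.2 ∈ Finset.range (s + 1) := Finset.mem_range.mpr (by omega)
  have hα' : α ∈ Finset.HasAntidiagonal.antidiagonal (α.1 + α.2) :=
    Finset.HasAntidiagonal.mem_antidiagonal.mpr rfl
  calc _ ≤ _ := le_mul_of_one_le_left (sq_nonneg _) h1
    _ ≤ _ := Finset.single_le_sum (f := fun α : ℕ × ℕ => ((s.factorial : ℝ) /
          ((s - (α.1 + α.2)).factorial * α.1.factorial * α.2.factorial)) *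
          ‖(partialDeriv α φ).toLp 2 (volume : Measure Plane)‖ ^ 2)
        (fun β _ => by positivity) hα'
    _ = ∑ β ∈ Finset.HasAntidiagonal.antidiagonal (α.1 + α.2), ((s.factorial : ℝ) /
          ((s - (α.1 + α.2)).factorial * β.1.factorial * β.2.factorial)) *
          ‖(partialDeriv β φ).toLp 2 (volume : Measure Plane)‖ ^ 2 :=
        Finset.sum_congr rfl fun β hβ => by
          rw [Finset.HasAntidiagonal.mem_antidiagonal.mp hβ]
    _ ≤ _ := Finset.single_le_sum (f := fun k : ℕ =>
          ∑ β ∈ Finset.HasAntidiagonal.antidiagonal k, ((s.factorial : ℝ) /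
          ((s - k).factorial * β.1.factorial * β.2.factorial)) *
          ‖(partialDeriv β φ).toLp 2 (volume : Measure Plane)‖ ^ 2)
        (fun k _ => Finset.sum_nonneg fun β _ => by positivity) hk

theorem laplacian_eq_partialDeriv (φ : 𝓢(Plane, ℂ)) :
    Δ φ = partialDeriv (2, 0) φ + partialDeriv (0, 2) φ := by
  rw [SchwartzMap.laplacian_eq_sum (EuclideanSpace.basisFun (Fin 2) ℝ), Fin.sum_univ_two]
  simp only [EuclideanSpace.basisFun_apply, partialDeriv, pow_zero, one_mul, mul_one, pow_two]
  rfl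

/-- The constant 3 counts `φ`, `∂₁²φ` and `∂₂²φ`, each of which enters the Sobolev norm with
coefficient 1. -/
theorem norm_toLp_sub_laplacian_le (φ : 𝓢(Plane, ℂ)) :
    ‖(φ - Δ φ).toLp 2 (volume : Measure Plane)‖ ≤ 3 * sobolevNorm 2 φ := by
  have h0 : ‖φ.toLp 2 (volume : Measure Plane)‖ ≤ sobolevNorm 2 φ :=
    norm_partialDeriv_le_sobolevNorm (α := (0, 0)) (by norm_num [Nat.factorial]) (by norm_num) φ
  have h1 := norm_partialDeriv_le_sobolevNorm (s := 2) (α := (2, 0))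
    (by norm_num [Nat.factorial]) (by norm_num) φ
  have h2 := norm_partialDeriv_le_sobolevNorm (s := 2) (α := (0, 2))
    (by norm_num [Nat.factorial]) (by norm_num) φ
  have e : (φ - Δ φ).toLp 2 (volume : Measure Plane) = φ.toLp 2 volume -
      ((partialDeriv (2, 0) φ).toLp 2 volume + (partialDeriv (0, 2) φ).toLp 2 volume) := by
    rw [laplacian_eq_partialDeriv]
    simp only [← SchwartzMap.toLpCLM_apply (𝕜 := ℂ), map_sub, map_add]
  rw [e]
  refine (norm_sub_le _ _).trans ?_
  linarith [norm_add_le ((partialDeriv (2, 0) φ).toLp 2 (volume : Measure Plane))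
    ((partialDeriv (0, 2) φ).toLp 2 (volume : Measure Plane))]

theorem sub_laplacian_apply (f : L2) (φ : 𝓢(Plane, ℂ)) :
    ((f : 𝓢'(Plane, ℂ)) - Δ (f : 𝓢'(Plane, ℂ))) φ = (f : 𝓢'(Plane, ℂ)) (φ - Δ φ) := by
  rw [map_sub, ← TemperedDistribution.laplacian_apply_apply]
  rfl

theorem norm_sub_laplacian_apply_le (f : L2) (φ : 𝓢(Plane, ℂ)) :
    ‖((f : 𝓢'(Plane, ℂ)) - Δ (f : 𝓢'(Plane, ℂ))) φ‖ ≤ 3 * ‖f‖ * sobolevNorm 2 φ := by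
  rw [sub_laplacian_apply]
  refine (norm_toDistribution_le _ _).trans ?_
  have := mul_le_mul_of_nonneg_left (norm_toLp_sub_laplacian_le φ) (norm_nonneg f)
  linarith

/-- The map `1 - Δ` from `L²(ℝ²)` to tempered distributions. -/
def subLaplacianDistribution : L2 →ₗ[ℂ] 𝓢'(Plane, ℂ) :=
  ((ContinuousLinearMap.id ℂ 𝓢'(Plane, ℂ) - LineDeriv.laplacianCLM ℂ Plane 𝓢'(Plane, ℂ)) ∘L
    Lp.toTemperedDistributionCLM ℂ volume 2).toLinearMap

theorem subLaplacianDistribution_apply (f : L2) :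
    subLaplacianDistribution f = (f : 𝓢'(Plane, ℂ)) - Δ (f : 𝓢'(Plane, ℂ)) := by
  rw [← TemperedDistribution.laplacianCLM_apply]
  rfl

/-- The map `1 - Δ` from `L²(ℝ²)` to `H⁻²(ℝ²)`, as a linear map. -/
def subLaplacianLinear : L2 →ₗ[ℂ] NegSobolev 2 :=
  LinearMap.codRestrict (negSobolevSubmodule 2) subLaplacianDistribution fun f =>
    ⟨3 * ‖f‖, fun φ => by
      rw [subLaplacianDistribution_apply]
      exact norm_sub_laplacian_apply_le f φ⟩

/-- The bounded operator `1 - Δ` from `L²(ℝ²)` to `H⁻²(ℝ²)`. -/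
def subLaplacian : L2 →L[ℂ] NegSobolev 2 :=
  LinearMap.mkContinuous subLaplacianLinear 3 fun f => by
    rw [NegSobolev.norm_def]
    refine ciSup_le fun φ => ?_
    change ‖subLaplacianDistribution f φ.1‖ ≤ _
    rw [subLaplacianDistribution_apply]
    refine (norm_sub_laplacian_apply_le f φ.1).trans ?_
    exact mul_le_of_le_one_right (by positivity) φ.2

theorem toDistribution_subLaplacian (f : L2) (φ : 𝓢(Plane, ℂ)) :
    (subLaplacian f).toDistribution φ = (f : 𝓢'(Plane, ℂ)) (φ - Δ φ) := by
  rw [← sub_laplacian_apply, ← subLaplacianDistribution_apply]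
  rfl

theorem toDistribution_subLaplacian_fourierInv (g : L2) (φ : 𝓢(Plane, ℂ)) :
    (subLaplacian (𝓕⁻ g)).toDistribution φ = ∫ ξ, 𝓕⁻ φ ξ * ((1 + symbol ξ : ℝ) * g ξ) := by
  rw [toDistribution_subLaplacian, toDistribution_fourierInv, toDistribution_apply]
  congr 1
  ext ξ
  have h : 𝓕⁻ (φ - Δ φ) = 𝓕⁻ φ - 𝓕⁻ (Δ φ) :=
    map_sub (FourierTransform.fourierInvCLM ℂ 𝓢(Plane, ℂ)) φ (Δ φ)
  rw [h, sub_apply, fourierInv_laplacian]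
  push_cast
  ring

/-! ### Existence of solutions -/

theorem exists_bounded_control {T : ℝ} {u : ℝ → ℂ} (hu : u ∈ controls T) :
    ∃ (v : ℝ → ℂ) (M : ℝ), Measurable v ∧ (∀ t, ‖v t‖ ≤ M) ∧
      v =ᵐ[volume.restrict (Ioo 0 T)] u := by
  obtain ⟨hm, hb⟩ := hu
  set M := (eLpNorm u ∞ (volume.restrict (Ioo 0 T))).toReal with hMdef
  have hM : ∀ᵐ t ∂(volume.restrict (Ioo 0 T)), ‖u t‖ ≤ M := by
    have := ae_le_eLpNormEssSup (f := u) (μ := volume.restrict (Ioo 0 T))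
    filter_upwards [this] with t ht
    rw [eLpNorm_exponent_top] at hb hMdef
    rw [hMdef, ← toReal_enorm]
    exact ENNReal.toReal_mono hb.ne ht
  have hM0 : 0 ≤ M := ENNReal.toReal_nonneg
  have hw := hm.stronglyMeasurable_mk.measurable
  -- Truncating a measurable representative at the essential supremum changes it only on a null set
  -- of `(0, T)` and makes the bound hold everywhere.
  refine ⟨fun t => if ‖hm.mk u t‖ ≤ M then hm.mk u t else 0, M, ?_, fun t => ?_, ?_⟩
  · exact Measurable.ite (measurableSet_le hw.norm measurable_const) hw measurable_const
  · by_cases h : ‖hm.mk u t‖ ≤ M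
    · simp [h]
    · simp [h, hM0]
  · filter_upwards [hM, hm.ae_eq_mk] with t h1 h2
    rw [h2] at h1
    simp only [h1, if_true]
    exact h2.symm

section Existence

variable {v : ℝ → ℂ} {M : ℝ}

/-- The Fourier transform of the solution with initial value `W₀` and control `v`. -/
def solutionSymbol (h : L2) (v : ℝ → ℂ) (t : ℝ) (ξ : Plane) : ℂ :=
  (Real.exp (-t * symbol ξ) : ℂ) * h ξ - 2 * duhamel v (symbol ξ) t

theorem memLp_solutionSymbol (h : L2) (hv : Measurable v) (hM : ∀ t, ‖v t‖ ≤ M) {t : ℝ}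
    (ht : 0 ≤ t) : MemLp (solutionSymbol h v t) 2 volume :=
  (memLp_exp_symbol_mul ht h).sub ((memLp_duhamel hv hM ht).const_mul 2)

theorem memLp_resolvent_mul {f : Plane → ℂ} (hf : MemLp f 2 volume) :
    MemLp (fun ξ => (resolvent ξ : ℂ) * f ξ) 2 volume := by
  refine hf.of_le ?_ (Eventually.of_forall fun ξ => ?_)
  · exact (Complex.continuous_ofReal.comp continuous_resolvent).aestronglyMeasurable.mul hf.1
  · rw [norm_mul, Complex.norm_real, Real.norm_of_nonneg (resolvent_pos ξ).le]
    exact mul_le_of_le_one_left (norm_nonneg _) (resolvent_le_one ξ)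

/-- The weight `(1 + λ)⁻¹` absorbs the factor `λ` from differentiating `exp (-t λ)`, and it makes
the control contribution square integrable in `ξ`. -/
theorem norm_solutionSymbol_sub_le (h : L2) (hv : Measurable v) (hM : ∀ t, ‖v t‖ ≤ M) {r t : ℝ}
    (hr : 0 ≤ r) (ht : 0 ≤ t) (ξ : Plane) :
    ‖(resolvent ξ : ℂ) * solutionSymbol h v r ξ - resolvent ξ * solutionSymbol h v t ξ‖ ≤
      (‖h ξ‖ + 4 * M * resolvent ξ) * |r - t| := by
  have h1 := abs_exp_sub_exp_le (symbol_nonneg ξ) hr ht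
  have h2 := norm_duhamel_sub_le hv hM (symbol_nonneg ξ) hr ht
  have hp := (resolvent_pos ξ).le
  have e : (resolvent ξ : ℂ) * solutionSymbol h v r ξ - resolvent ξ * solutionSymbol h v t ξ =
      resolvent ξ * (((Real.exp (-r * symbol ξ) - Real.exp (-t * symbol ξ) : ℝ) : ℂ) * h ξ -
        2 * (duhamel v (symbol ξ) r - duhamel v (symbol ξ) t)) := by
    simp only [solutionSymbol]
    push_cast
    ring
  rw [e, norm_mul, Complex.norm_real, Real.norm_of_nonneg hp]
  have h3 : ‖((Real.exp (-r * symbol ξ) - Real.exp (-t * symbol ξ) : ℝ) : ℂ) * h ξ -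
      2 * (duhamel v (symbol ξ) r - duhamel v (symbol ξ) t)‖ ≤
      symbol ξ * |r - t| * ‖h ξ‖ + 2 * (2 * M * |r - t|) := by
    refine (norm_sub_le _ _).trans (add_le_add ?_ ?_)
    · rw [norm_mul, Complex.norm_real, Real.norm_eq_abs]
      exact mul_le_mul_of_nonneg_right h1 (norm_nonneg _)
    · rw [norm_mul, Complex.norm_ofNat]
      exact mul_le_mul_of_nonneg_left h2 zero_le_two
  calc _ ≤ resolvent ξ * (symbol ξ * |r - t| * ‖h ξ‖ + 2 * (2 * M * |r - t|)) :=
        mul_le_mul_of_nonneg_left h3 hp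
    _ = (symbol ξ * resolvent ξ) * (‖h ξ‖ * |r - t|) + 4 * M * resolvent ξ * |r - t| := by ring
    _ ≤ 1 * (‖h ξ‖ * |r - t|) + 4 * M * resolvent ξ * |r - t| := by
        gcongr
        exact symbol_mul_resolvent_le_one ξ
    _ = _ := by ring

theorem hasDerivAt_solutionSymbol (h : L2) (hv : Measurable v) (hM : ∀ t, ‖v t‖ ≤ M) {t : ℝ}
    (hd : HasDerivAt (fun r => ∫ s in 0..r, v s) (v t) t) (ξ : Plane) :
    HasDerivAt (fun r => solutionSymbol h v r ξ)
      (-(symbol ξ : ℂ) * solutionSymbol h v t ξ - 2 * v t) t := by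
  have hexp : HasDerivAt (fun r : ℝ => (Real.exp (-r * symbol ξ) : ℂ))
      ((Real.exp (-t * symbol ξ) * (-1 * symbol ξ) : ℝ) : ℂ) t :=
    (((hasDerivAt_id t).neg.mul_const (symbol ξ)).exp).ofReal_comp
  have h1 := (hexp.mul_const (h ξ)).sub
    ((hasDerivAt_duhamel hv hM (symbol ξ) hd).const_mul 2)
  refine h1.congr_deriv ?_
  simp only [solutionSymbol, Complex.ofReal_mul, Complex.ofReal_neg, Complex.ofReal_one]
  ring

/-- The restriction of the time to `[0, T]`. -/
def clamp (T t : ℝ) : ℝ := max 0 (min T t)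

theorem clamp_nonneg (T t : ℝ) : 0 ≤ clamp T t := le_max_left _ _

theorem clamp_of_mem {T t : ℝ} (ht : t ∈ Icc 0 T) : clamp T t = t := by
  rw [clamp, min_eq_right ht.2, max_eq_right ht.1]

theorem abs_clamp_sub_clamp_le (T r t : ℝ) : |clamp T r - clamp T t| ≤ |r - t| := by
  unfold clamp
  refine (abs_max_sub_max_le_max 0 _ 0 _).trans ?_
  rw [sub_self, abs_zero, max_eq_right (abs_nonneg _)]
  refine (abs_min_sub_min_le_max T r T t).trans ?_
  rw [sub_self, abs_zero, max_eq_right (abs_nonneg _)]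

/-- The solution with initial value `W₀` and control `v`. -/
def solution (T : ℝ) (W₀ : EvenL2) (hv : Measurable v) (hM : ∀ t, ‖v t‖ ≤ M) (t : ℝ) : EvenL2 :=
  -- The path must be defined for all real times, while `exp (-t λ)` is unbounded in `ξ` for
  -- negative `t`; hence the clamped time.
  ⟨𝓕⁻ ((memLp_solutionSymbol (𝓕 (W₀ : L2)) hv hM (clamp_nonneg T t)).toLp _), by
    refine fourierInv_mem_evenL2 (toLp_mem_evenL2 _ ?_)
    filter_upwards [coeFn_comp_reflect (fourier_mem_evenL2 W₀.2)] with ξ hξ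
    simp only [solutionSymbol, symbol_reflect, hξ]⟩

theorem isEven_of_hasDerivAt {s : ℕ} {V : ℝ → NegSobolev s} {V' : NegSobolev s} {t : ℝ}
    (hd : HasDerivAt V V' t) (hV : ∀ᶠ r in 𝓝 t, IsEven (V r).toDistribution) :
    IsEven V'.toDistribution := by
  intro φ
  have h1 := NegSobolev.hasDerivAt_apply hd φ
  have h2 := NegSobolev.hasDerivAt_apply hd (reflectTest φ)
  refine h1.unique (h2.congr_of_eventuallyEq ?_)
  filter_upwards [hV] with r hr
  exact hr φ

/-- The path in `H⁻²` is written as `J (Q t)`, where `Q t` is `(1 + λ)⁻¹` times the solution symbol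
and `J` is `1 - Δ` after the inverse transform. Regularity in time is proved for `Q` in `L²` and
carried over by the bounded map `J`. -/
theorem isSolution_solution {T : ℝ} (hT : 0 < T) {u : ℝ → ℂ} (W₀ : EvenL2) (hv : Measurable v)
    (hM : ∀ t, ‖v t‖ ≤ M) (huv : v =ᵐ[volume.restrict (Ioo 0 T)] u) :
    IsSolution T u W₀ (solution T W₀ hv hM) := by
  set h : L2 := 𝓕 (W₀ : L2) with hh
  have hw (t : ℝ) := memLp_solutionSymbol h hv hM (clamp_nonneg T t)
  have hq (t : ℝ) := memLp_resolvent_mul (hw t)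
  have hb : MemLp (fun ξ => ‖h ξ‖ + 4 * M * resolvent ξ) 2 volume :=
    (Lp.memLp h).norm.add (memLp_resolvent.const_mul (4 * M))
  have hbound (r t : ℝ) (ξ : Plane) :
      ‖(resolvent ξ : ℂ) * solutionSymbol h v (clamp T r) ξ -
        resolvent ξ * solutionSymbol h v (clamp T t) ξ‖ ≤
      (‖h ξ‖ + 4 * M * resolvent ξ) * |r - t| := by
    refine (norm_solutionSymbol_sub_le h hv hM (clamp_nonneg T r) (clamp_nonneg T t) ξ).trans ?_
    have hM0 : 0 ≤ M := (norm_nonneg _).trans (hM 0)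
    have := (resolvent_pos ξ).le
    exact mul_le_mul_of_nonneg_left (abs_clamp_sub_clamp_le T r t) (by positivity)
  set Q : ℝ → L2 := fun t => (hq t).toLp _ with hQ
  have hLip : LipschitzWith ‖hb.toLp _‖₊ Q := by
    refine LipschitzWith.of_dist_le_mul fun r t => ?_
    rw [dist_eq_norm, Real.dist_eq, hQ]
    simp only
    rw [← MemLp.toLp_sub (hq r) (hq t), coe_nnnorm, mul_comm]
    refine Lp.norm_le_mul_norm_of_ae_le_mul ?_
    filter_upwards [((hq r).sub (hq t)).coeFn_toLp, hb.coeFn_toLp] with ξ h1 h2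
    rw [h1, h2, mul_comm]
    refine (hbound r t ξ).trans ?_
    exact mul_le_mul_of_nonneg_right (le_abs_self _) (abs_nonneg _)
  set J : L2 → NegSobolev 2 := fun g => subLaplacian (𝓕⁻ g) with hJ
  have hJlip := (subLaplacian ∘L FourierTransform.fourierInvCLM ℂ L2).lipschitz
  have hVW (t : ℝ) : (J (Q t)).toDistribution =
      ((solution T W₀ hv hM t : L2) : 𝓢'(Plane, ℂ)) := by
    ext φ
    rw [hJ, toDistribution_subLaplacian_fourierInv, solution, toDistribution_fourierInv,
      toDistribution_apply]
    refine integral_congr_ae ?_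
    filter_upwards [(hq t).coeFn_toLp, (hw t).coeFn_toLp] with ξ h1 h2
    rw [hQ, h1, h2, ← mul_assoc _ (resolvent ξ : ℂ), ← Complex.ofReal_mul,
      one_add_symbol_mul_resolvent, Complex.ofReal_one, one_mul]
  refine ⟨?_, fun t => J (Q t), fun t _ => hVW t, ?_, ?_⟩
  · refine Subtype.ext ?_
    have hc : clamp T 0 = 0 := clamp_of_mem ⟨le_rfl, hT.le⟩
    change (𝓕⁻ ((hw 0).toLp _) : L2) = W₀
    rw [← FourierTransform.fourierInv_fourier_eq (E := L2) (F := L2) (W₀ : L2), ← hh]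
    congr 1
    refine Lp.ext ?_
    filter_upwards [(hw 0).coeFn_toLp] with ξ hξ
    rw [hξ, hc, solutionSymbol, duhamel]
    simp
  · exact absolutelyContinuousOnInterval_comp hJlip
      hLip.lipschitzOnWith.absolutelyContinuousOnInterval
  · have hderiv := LocallyIntegrable.ae_hasDerivAt_integral (locallyIntegrable_of_bound hv hM)
    filter_upwards [huv, ae_restrict_mem measurableSet_Ioo, ae_restrict_of_ae hderiv]
      with t hut ht hdt
    have hct : clamp T t = t := clamp_of_mem (Ioo_subset_Icc_self ht)
    have hev : ∀ᶠ r in 𝓝 t, clamp T r = r := by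
      filter_upwards [Ioo_mem_nhds ht.1 ht.2] with r hr using clamp_of_mem (Ioo_subset_Icc_self hr)
    -- This pointwise derivative need not be square integrable, since it contains the constant `2
    -- v(t)`; its product with `resolvent` is.
    set w' : Plane → ℂ := fun ξ => -(symbol ξ : ℂ) * solutionSymbol h v t ξ - 2 * v t with hw'
    have hq' : MemLp (fun ξ => (resolvent ξ : ℂ) * w' ξ) 2 volume := by
      have h1 : MemLp (fun ξ => ((symbol ξ * resolvent ξ : ℝ) : ℂ) * solutionSymbol h v t ξ)
          2 volume := by
        have hs := memLp_solutionSymbol h hv hM ht.1.le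
        refine hs.of_le ?_ (Eventually.of_forall fun ξ => ?_)
        · exact (Complex.continuous_ofReal.comp
            (continuous_symbol.mul continuous_resolvent)).aestronglyMeasurable.mul hs.1
        · rw [norm_mul, Complex.norm_real, Real.norm_of_nonneg
            (mul_nonneg (symbol_nonneg ξ) (resolvent_pos ξ).le)]
          exact mul_le_of_le_one_left (norm_nonneg _) (symbol_mul_resolvent_le_one ξ)
      have h2 : MemLp (fun ξ => (resolvent ξ : ℂ) * (2 * v t)) 2 volume :=
        (memLp_resolvent.ofReal (K := ℂ)).mul_const (2 * v t)
      refine (h1.neg.sub h2).ae_eq (Eventually.of_forall fun ξ => ?_)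
      simp only [hw', Pi.sub_apply, Pi.neg_apply]
      push_cast
      ring
    have hQd : HasDerivAt Q (hq'.toLp _) t := by
      refine hasDerivAt_toLp hq hq' hb (fun s => Eventually.of_forall fun ξ => hbound s t ξ)
        (Eventually.of_forall fun ξ => ?_)
      refine HasDerivAt.const_mul (resolvent ξ : ℂ) ?_
      refine (hasDerivAt_solutionSymbol h hv hM (hdt 0) ξ).congr_of_eventuallyEq ?_
      filter_upwards [hev] with r hr
      rw [hr]
    have hVd : HasDerivAt (fun r => J (Q r)) (J (hq'.toLp _)) t :=
      ((subLaplacian ∘L FourierTransform.fourierInvCLM ℂ L2).restrictScalars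
        ℝ).hasFDerivAt.comp_hasDerivAt t hQd
    refine ⟨J (hq'.toLp _), hVd, isEven_of_hasDerivAt hVd (Eventually.of_forall fun r => ?_), ?_⟩
    · rw [hVW r]
      exact (solution T W₀ hv hM r).2
    · ext φ
      rw [hJ, toDistribution_subLaplacian_fourierInv]
      have hR : (Δ ((solution T W₀ hv hM t : L2) : 𝓢'(Plane, ℂ)) -
          (2 * u t) • TemperedDistribution.delta (0 : Plane)) φ =
          ((solution T W₀ hv hM t : L2) : 𝓢'(Plane, ℂ)) (Δ φ) - 2 * u t * φ 0 := by
        rw [← TemperedDistribution.laplacian_apply_apply, ← TemperedDistribution.delta_apply]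
        rfl
      rw [hR, solution, toDistribution_fourierInv, toDistribution_apply, apply_zero_eq_integral,
        ← integral_const_mul, ← integral_sub]
      · refine integral_congr_ae ?_
        filter_upwards [hq'.coeFn_toLp, (hw t).coeFn_toLp] with ξ h1 h2
        rw [h1, h2, fourierInv_laplacian, ← mul_assoc _ (resolvent ξ : ℂ), ← Complex.ofReal_mul,
          one_add_symbol_mul_resolvent, hct, ← hut, hw']
        push_cast
        ring
      · exact ((𝓕⁻ (Δ φ)).memLp 2 volume).integrable_mul (Lp.memLp _)
      · exact (𝓕⁻ φ).integrable.const_mul _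

end Existence

/-! ### The end states of the solutions -/

/-- The free evolution of `W₀` at time `T`, as an element of `L²(ℝ²)`. -/
def freeState {T : ℝ} (hT : 0 ≤ T) (W₀ : EvenL2) : L2 :=
  𝓕⁻ ((memLp_exp_symbol_mul hT (𝓕 (W₀ : L2))).toLp _)

section ControlTerm

variable {v : ℝ → ℂ} {M : ℝ}

theorem memLp_neg_two_mul_duhamel {T : ℝ} (hT : 0 ≤ T) (hv : Measurable v) (hM : ∀ t, ‖v t‖ ≤ M) :
    MemLp (fun ξ : Plane => -2 * duhamel v (symbol ξ) T) 2 volume :=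
  (memLp_duhamel hv hM hT).const_mul (-2)

/-- The end state of the solution with initial value `0` and control `v`. -/
def controlTerm {T : ℝ} (hT : 0 ≤ T) (hv : Measurable v) (hM : ∀ t, ‖v t‖ ≤ M) : L2 :=
  𝓕⁻ ((memLp_neg_two_mul_duhamel hT hv hM).toLp _)

theorem coe_solution_end {T : ℝ} (hT : 0 ≤ T) (W₀ : EvenL2) (hv : Measurable v)
    (hM : ∀ t, ‖v t‖ ≤ M) :
    (solution T W₀ hv hM T : L2) = freeState hT W₀ + controlTerm hT hv hM := by
  have hc : clamp T T = T := clamp_of_mem ⟨hT, le_rfl⟩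
  change (𝓕⁻ ((memLp_solutionSymbol _ hv hM (clamp_nonneg T T)).toLp _) : L2) = _
  rw [freeState, controlTerm, ← FourierTransform.fourierInv_add, ← MemLp.toLp_add
    (memLp_exp_symbol_mul hT _) (memLp_neg_two_mul_duhamel hT hv hM)]
  congr 1
  refine MemLp.toLp_congr _ _ (Eventually.of_forall fun ξ => ?_)
  simp only [hc, solutionSymbol, Pi.add_apply]
  ring

/-- The symbol depends on `ξ` only through `‖ξ‖²`, and the inverse transform keeps radial functions
radial. -/
theorem controlTerm_mem_radialSubmodule {T : ℝ} (hT : 0 ≤ T) (hv : Measurable v)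
    (hM : ∀ t, ‖v t‖ ≤ M) : controlTerm hT hv hM ∈ radialSubmodule := by
  refine fourierInv_mem_radialSubmodule ?_
  have hc : (fun ξ : Plane => -2 * duhamel v (symbol ξ) T) =
      (fun r : ℝ≥0 => -2 * duhamel v ((2 * Real.pi) ^ 2 * r) T) ∘ normSq := by
    ext ξ
    simp only [Function.comp_apply, coe_normSq]
    rfl
  have hm : Measurable fun r : ℝ≥0 => -2 * duhamel v ((2 * Real.pi) ^ 2 * r) T :=
    ((measurable_duhamel hv T).comp (by fun_prop)).const_mul (-2)
  have h2 := memLp_neg_two_mul_duhamel hT hv hM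
  have hL := h2
  rw [hc] at hL
  refine toLp_mem_radialSubmodule (memLp_comp_normSq hm.aestronglyMeasurable hL) ?_
  rw [← hc]
  exact h2.coeFn_toLp

theorem controlTerm_add {T : ℝ} (hT : 0 ≤ T) (hv : Measurable v) (hM : ∀ t, ‖v t‖ ≤ M)
    {v' : ℝ → ℂ} {M' : ℝ} (hv' : Measurable v') (hM' : ∀ t, ‖v' t‖ ≤ M')
    (hs : Measurable (v + v')) {M'' : ℝ} (hM'' : ∀ t, ‖(v + v') t‖ ≤ M'') :
    controlTerm hT hs hM'' = controlTerm hT hv hM + controlTerm hT hv' hM' := by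
  rw [controlTerm, controlTerm, controlTerm, ← FourierTransform.fourierInv_add, ← MemLp.toLp_add]
  congr 1
  refine MemLp.toLp_congr _ _ (Eventually.of_forall fun ξ => ?_)
  simp only [Pi.add_apply, duhamel, mul_add]
  rw [intervalIntegral.integral_add (intervalIntegrable_mul hv hM (by fun_prop) _ _)
    (intervalIntegrable_mul hv' hM' (by fun_prop) _ _), mul_add]

theorem controlTerm_smul {T : ℝ} (hT : 0 ≤ T) (hv : Measurable v) (hM : ∀ t, ‖v t‖ ≤ M) (c : ℝ)
    (hs : Measurable (c • v)) {M' : ℝ} (hM' : ∀ t, ‖(c • v) t‖ ≤ M') :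
    controlTerm hT hs hM' = c • controlTerm hT hv hM := by
  have hc : c • controlTerm hT hv hM = (c : ℂ) • controlTerm hT hv hM :=
    (Complex.coe_smul c _).symm
  rw [hc, controlTerm, controlTerm, ← FourierTransform.fourierInv_smul,
    ← MemLp.toLp_const_smul]
  congr 1
  refine MemLp.toLp_congr _ _ (Eventually.of_forall fun ξ => ?_)
  have e : duhamel (c • v) (symbol ξ) T = c * duhamel v (symbol ξ) T := by
    rw [duhamel, duhamel, ← intervalIntegral.integral_const_mul]
    refine intervalIntegral.integral_congr fun s _ => ?_
    simp only [Pi.smul_apply, Complex.real_smul]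
    ring
  simp only [Pi.smul_apply, smul_eq_mul, e]
  ring

end ControlTerm

/-- The end states of the solutions with initial value `0` and bounded controls with values
in `P`. -/
def controlTerms {T : ℝ} (hT : 0 ≤ T) (P : Submodule ℝ ℂ) : Submodule ℝ L2 where
  carrier := {f | ∃ (v : ℝ → ℂ) (M : ℝ) (hv : Measurable v) (hM : ∀ t, ‖v t‖ ≤ M),
    (∀ t, v t ∈ P) ∧ f = controlTerm hT hv hM}
  add_mem' := by
    rintro _ _ ⟨v, M, hv, hM, hP, rfl⟩ ⟨v', M', hv', hM', hP', rfl⟩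
    exact ⟨v + v', M + M', hv.add hv', fun t => (norm_add_le _ _).trans (add_le_add (hM t) (hM' t)),
      fun t => P.add_mem (hP t) (hP' t), (controlTerm_add hT hv hM hv' hM' _ _).symm⟩
  zero_mem' := by
    have h0 : ∀ t, ‖((0 : ℝ) • (0 : ℝ → ℂ)) t‖ ≤ 0 := fun t => by simp
    have h1 : ∀ t, ‖(0 : ℝ → ℂ) t‖ ≤ 0 := fun t => by simp
    -- The zero control is written as a multiple so that `controlTerm_smul` applies.
    refine ⟨(0 : ℝ) • 0, 0, measurable_zero.const_smul _, h0, fun t => by simp, ?_⟩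
    rw [controlTerm_smul hT measurable_zero h1 0, zero_smul]
  smul_mem' := by
    rintro c _ ⟨v, M, hv, hM, hP, rfl⟩
    refine ⟨c • v, |c| * M, hv.const_smul c, fun t => ?_, fun t => P.smul_mem c (hP t),
      (controlTerm_smul hT hv hM c _ _).symm⟩
    rw [Pi.smul_apply, norm_smul, Real.norm_eq_abs]
    exact mul_le_mul_of_nonneg_left (hM t) (abs_nonneg c)

theorem controlTerms_subset_radialSubmodule {T : ℝ} (hT : 0 ≤ T) (P : Submodule ℝ ℂ) :
    (controlTerms hT P : Set L2) ⊆ radialSubmodule := by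
  rintro _ ⟨v, M, hv, hM, -, rfl⟩
  exact controlTerm_mem_radialSubmodule hT hv hM

/-- Up to changes on null sets, the controls of the class `U` are the bounded measurable functions
with values in `P`. -/
structure ControlClass (T : ℝ) (U : Set (ℝ → ℂ)) (P : Submodule ℝ ℂ) : Prop where
  exists_bounded : ∀ u ∈ U, ∃ (v : ℝ → ℂ) (M : ℝ), Measurable v ∧ (∀ t, ‖v t‖ ≤ M) ∧
    (∀ t, v t ∈ P) ∧ v =ᵐ[volume.restrict (Ioo 0 T)] u
  mem : ∀ (v : ℝ → ℂ) (M : ℝ), Measurable v → (∀ t, ‖v t‖ ≤ M) → (∀ t, v t ∈ P) → v ∈ U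

theorem mem_controls_of_bounded (T : ℝ) {v : ℝ → ℂ} {M : ℝ} (hv : Measurable v)
    (hM : ∀ t, ‖v t‖ ≤ M) : v ∈ controls T :=
  memLp_top_of_bound hv.aestronglyMeasurable M (Eventually.of_forall hM)

theorem controlClass_controls (T : ℝ) : ControlClass T (controls T) ⊤ where
  exists_bounded u hu := by
    obtain ⟨v, M, hv, hM, hvu⟩ := exists_bounded_control hu
    exact ⟨v, M, hv, hM, fun t => trivial, hvu⟩
  mem v M hv hM _ := mem_controls_of_bounded T hv hM

/-- The real line in the complex plane. -/
def realLine : Submodule ℝ ℂ := LinearMap.range Complex.ofRealCLM.toLinearMap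

theorem ofReal_mem_realLine (r : ℝ) : (r : ℂ) ∈ realLine := ⟨r, rfl⟩

theorem controlClass_realControls (T : ℝ) : ControlClass T (realControls T) realLine where
  exists_bounded u hu := by
    obtain ⟨v, M, hv, hM, hvu⟩ := exists_bounded_control hu.1
    refine ⟨fun t => ((v t).re : ℂ), M, by fun_prop, fun t => ?_, fun t => ofReal_mem_realLine _, ?_⟩
    · rw [Complex.norm_real, Real.norm_eq_abs]
      exact (Complex.abs_re_le_norm _).trans (hM t)
    · filter_upwards [hvu, hu.2] with t h1 h2
      rw [h1]
      exact Complex.ext rfl h2.symm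
  mem v M hv hM hP := by
    refine ⟨mem_controls_of_bounded T hv hM, Eventually.of_forall fun t => ?_⟩
    obtain ⟨r, hr⟩ := hP t
    rw [← hr]
    exact Complex.ofReal_im r

/-- The equation sees a control only up to null sets, so a bounded representative may be used;
uniqueness identifies any solution with the explicit one. -/
theorem image_reachable {T : ℝ} (hT : 0 < T) {U : Set (ℝ → ℂ)} {P : Submodule ℝ ℂ}
    (hU : ControlClass T U P) (W₀ : EvenL2) :
    ((↑) : EvenL2 → L2) '' reachable U T W₀ =
      (fun f => freeState hT.le W₀ + f) '' (controlTerms hT.le P : Set L2) := by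
  have hTmem : T ∈ Icc 0 T := ⟨hT.le, le_rfl⟩
  ext f
  constructor
  · rintro ⟨Wend, ⟨u, hu, W, hW, -, rfl⟩, rfl⟩
    obtain ⟨v, M, hv, hM, hP, hvu⟩ := hU.exists_bounded u hu
    refine ⟨controlTerm hT.le hv hM, ⟨v, M, hv, hM, hP, rfl⟩, ?_⟩
    simp only
    rw [← coe_solution_end, hW.eqOn hT (isSolution_solution hT W₀ hv hM hvu) hTmem]
  · rintro ⟨_, ⟨v, M, hv, hM, hP, rfl⟩, rfl⟩
    have hsol := isSolution_solution hT W₀ hv hM (EventuallyEq.refl _ v)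
    exact ⟨solution T W₀ hv hM T, ⟨v, hU.mem v M hv hM hP, _, hsol,
      fun W' hW' => hsol.eqOn hT hW', rfl⟩, coe_solution_end hT.le W₀ hv hM⟩

theorem approxControllable_iff {T : ℝ} (hT : 0 < T) {U : Set (ℝ → ℂ)} {P : Submodule ℝ ℂ}
    (hU : ControlClass T U P) (W₀ Wend : EvenL2) :
    ApproxControllable U T W₀ Wend ↔
      (Wend : L2) - freeState hT.le W₀ ∈ closure (controlTerms hT.le P : Set L2) := by
  rw [ApproxControllable, closure_subtype, image_reachable hT hU]
  have := (Homeomorph.addLeft (freeState hT.le W₀)).image_closure (controlTerms hT.le P : Set L2)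
  rw [Homeomorph.coe_addLeft] at this
  rw [← this]
  constructor
  · rintro ⟨f, hf, hfe⟩
    rwa [← hfe, add_sub_cancel_left]
  · intro h
    exact ⟨_, h, add_sub_cancel _ _⟩

/-! ### Gaussians are limits of end states -/

theorem tendsto_average_left {k : ℝ → ℂ} (hk : Continuous k) (a : ℝ) :
    Tendsto (fun ε : ℝ => ((ε⁻¹ : ℝ) : ℂ) * ∫ r in (a - ε)..a, k r) (𝓝[>] 0) (𝓝 (k a)) := by
  have hd := intervalIntegral.integral_hasDerivAt_left (hk.intervalIntegrable a a)
    (hk.stronglyMeasurableAtFilter _ _) hk.continuousAt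
  have h := hd.scomp_of_eq (0 : ℝ) ((hasDerivAt_id (0 : ℝ)).const_sub a) (by simp)
  rw [hasDerivAt_iff_tendsto_slope] at h
  have h2 := h.mono_left (nhdsWithin_mono 0 (fun x hx => ne_of_gt hx) : 𝓝[>] (0 : ℝ) ≤ 𝓝[≠] 0)
  simp only [neg_smul, one_smul, neg_neg] at h2
  refine h2.congr fun ε => ?_
  simp [slope_def_module, Function.comp_def]

theorem duhamel_indicator {T a ε : ℝ} (ha : a ≤ T) (hε : 0 ≤ ε) (haε : 0 ≤ a - ε) (c : ℂ)
    (lam : ℝ) : duhamel ((Ioc (a - ε) a).indicator fun _ => c) lam T =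
      (∫ r in (a - ε)..a, (Real.exp (-lam * (T - r)) : ℂ)) * c := by
  have h1 : (fun s => (Real.exp (-lam * (T - s)) : ℂ) *
      (Ioc (a - ε) a).indicator (fun _ => c) s) =
      (Ioc (a - ε) a).indicator fun s => (Real.exp (-lam * (T - s)) : ℂ) * c := by
    ext s
    by_cases hs : s ∈ Ioc (a - ε) a <;> simp [hs]
  rw [duhamel, h1, intervalIntegral.integral_of_le (by linarith),
    setIntegral_indicator measurableSet_Ioc,
    inter_eq_self_of_subset_right (Ioc_subset_Ioc haε ha), ← intervalIntegral.integral_mul_const,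
    intervalIntegral.integral_of_le (by linarith)]

theorem fourierInv_smul_gaussian_mem_closure {T : ℝ} (hT : 0 ≤ T) {P : Submodule ℝ ℂ} {c : ℂ}
    (hc : c ∈ P) {s : ℝ} (hs : 0 < s) (hsT : s < T) (hb : 0 < (2 * Real.pi) ^ 2 * s) :
    (𝓕⁻ (c • gaussian ((2 * Real.pi) ^ 2 * s) hb) : L2) ∈
      closure (controlTerms hT P : Set L2) := by
  set a := T - s with ha
  -- These controls approximate `-c/2` times a unit impulse at time `a = T - s`; the factor `-1/2`
  -- cancels the `-2` of the equation.
  set v : ℝ → ℝ → ℂ := fun ε => (Ioc (a - ε) a).indicator fun _ => ((-(2 * ε)⁻¹ : ℝ) : ℂ) * c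
    with hvdef
  have hv (ε : ℝ) : Measurable (v ε) := measurable_const.indicator measurableSet_Ioc
  have hM (ε : ℝ) : ∀ t, ‖v ε t‖ ≤ ‖((-(2 * ε)⁻¹ : ℝ) : ℂ) * c‖ := fun t =>
    norm_indicator_le_norm_self _ _
  have hF (ε : ℝ) := memLp_neg_two_mul_duhamel hT (hv ε) (hM ε)
  have hg : MemLp (fun ξ : Plane => c * (Real.exp (-s * symbol ξ) : ℂ)) 2 volume := by
    refine ((memLp_gaussian hb).const_mul c).ae_eq (Eventually.of_forall fun ξ => ?_)
    simp only [symbol]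
    congr 3
    ring
  have hform : ∀ ε, 0 < ε → ε < a → ∀ ξ : Plane, -2 * duhamel (v ε) (symbol ξ) T =
      c * (((ε⁻¹ : ℝ) : ℂ) * ∫ r in (a - ε)..a, (Real.exp (-symbol ξ * (T - r)) : ℂ)) := by
    intro ε hε hεa ξ
    rw [duhamel_indicator (by linarith) hε.le (by linarith)]
    have : (ε : ℂ) ≠ 0 := by exact_mod_cast hε.ne'
    push_cast
    field_simp
  have hlim : Tendsto (fun ε => (hF ε).toLp _) (𝓝[>] 0) (𝓝 (hg.toLp _)) := by
    have hev : ∀ᶠ ε in 𝓝[>] (0 : ℝ), 0 < ε ∧ ε < a :=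
      Ioo_mem_nhdsGT (by linarith : (0 : ℝ) < a)
    -- The window lies before `a`, so `T - r ≥ s` on it and each approximant is bounded by the limit
    -- Gaussian in modulus. The difference is then at most twice that Gaussian.
    refine tendsto_toLp_of_dominated hF hg (hg.norm.const_mul 2) ?_ ?_
    · filter_upwards [hev] with ε ⟨hε, hεa⟩
      refine Eventually.of_forall fun ξ => (norm_sub_le _ _).trans ?_
      rw [two_mul]
      refine add_le_add_left ?_ _
      rw [hform ε hε hεa ξ, norm_mul, norm_mul, norm_mul, Complex.norm_real, Complex.norm_real,
        Real.norm_of_nonneg (inv_nonneg.mpr hε.le), Real.norm_of_nonneg (Real.exp_nonneg _)]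
      refine mul_le_mul_of_nonneg_left ?_ (norm_nonneg _)
      rw [inv_mul_le_iff₀ hε]
      have := intervalIntegral.norm_integral_le_of_norm_le_const (a := a - ε) (b := a)
        (C := Real.exp (-s * symbol ξ)) (f := fun r => (Real.exp (-symbol ξ * (T - r)) : ℂ))
        fun r hr => by
          rw [uIoc_of_le (by linarith)] at hr
          rw [Complex.norm_real, Real.norm_of_nonneg (Real.exp_nonneg _)]
          refine Real.exp_le_exp.mpr ?_
          have := symbol_nonneg ξ
          nlinarith [hr.2]
      rwa [sub_sub_cancel, abs_of_pos hε, mul_comm] at this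
    · refine Eventually.of_forall fun ξ => ?_
      have h := (tendsto_average_left (k := fun r => (Real.exp (-symbol ξ * (T - r)) : ℂ))
        (by fun_prop) a).const_mul c
      have e : -symbol ξ * (T - a) = -s * symbol ξ := by
        rw [ha]
        ring
      rw [e] at h
      refine h.congr' ?_
      filter_upwards [hev] with ε ⟨hε, hεa⟩
      exact (hform ε hε hεa ξ).symm
  have hlim' := ((FourierTransform.fourierInvCLM ℂ L2).continuous.tendsto _).comp hlim
  have hgg : hg.toLp _ = c • gaussian ((2 * Real.pi) ^ 2 * s) hb := by
    rw [gaussian, ← MemLp.toLp_const_smul]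
    refine MemLp.toLp_congr _ _ (Eventually.of_forall fun ξ => ?_)
    simp only [symbol, Pi.smul_apply, smul_eq_mul]
    congr 3
    ring
  rw [hgg] at hlim'
  refine mem_closure_of_tendsto hlim' (Eventually.of_forall fun ε => ?_)
  refine ⟨v ε, _, hv ε, hM ε, fun t => ?_, rfl⟩
  simp only [hvdef]
  by_cases ht : t ∈ Ioc (a - ε) a
  · rw [indicator_of_mem ht, ← Complex.real_smul]
    exact P.smul_mem _ hc
  · rw [indicator_of_notMem ht]
    exact P.zero_mem

theorem gaussian_congr {p q : ℝ} (h : p = q) (hp : 0 < p) (hq : 0 < q) :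
    gaussian p hp = gaussian q hq := by
  subst h
  rfl

theorem smul_gaussian_mem_closure {T : ℝ} (hT : 0 < T) {P : Submodule ℝ ℂ} {c : ℂ}
    (hc : c ∈ P) {p : ℝ} (hp : 0 < p) (hpT : 1 / (4 * T) < p) :
    c • gaussian p hp ∈ closure (controlTerms hT.le P : Set L2) := by
  have hpi := Real.pi_pos
  have hs : 0 < 1 / (4 * p) := by positivity
  have hb : 0 < (2 * Real.pi) ^ 2 * (1 / (4 * p)) := by positivity
  have hsT : 1 / (4 * p) < T := by
    rw [div_lt_iff₀ (by positivity)] at hpT ⊢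
    linarith
  -- The choice `s = 1 / (4p)` gives `π² / ((2π)² s) = p`, and `s < T` is the condition on `p`. The
  -- real factor `π / p` cancels the constant `p / π` of the transform.
  have h := fourierInv_smul_gaussian_mem_closure hT.le (P.smul_mem (Real.pi / p) hc) hs hsT hb
  have hsmul (z : ℂ) (f : L2) : (𝓕⁻ (z • f) : L2) = z • 𝓕⁻ f :=
    map_smul (FourierTransform.fourierInvCLM ℂ L2) z f
  rw [hsmul, fourierInv_gaussian, smul_smul, Complex.real_smul,
    gaussian_congr (q := p) (by field_simp; ring) _ hp] at h
  convert h using 2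
  have hp' : (p : ℂ) ≠ 0 := by exact_mod_cast hp.ne'
  have hpi' : (Real.pi : ℂ) ≠ 0 := by exact_mod_cast hpi.ne'
  push_cast
  field_simp
  ring

/-- The Gaussians are total over `ℂ`, whereas the control terms form only a real subspace. The map
`Φ` mediates: the identity for complex controls, the real part for real ones. -/
theorem map_radial_mem_closure {T : ℝ} (hT : 0 < T) {P : Submodule ℝ ℂ} (Φ : L2 →L[ℝ] L2)
    (hΦ : ∀ (c : ℂ) (p : ℝ) (hp : 0 < p), ∃ d ∈ P, Φ (c • gaussian p hp) = d • gaussian p hp)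
    {f : L2} (hf : f ∈ radialSubmodule) : Φ f ∈ closure (controlTerms hT.le P : Set L2) := by
  rw [← Submodule.topologicalClosure_coe]
  have hcl : f ∈ closure (Submodule.span ℂ (gaussians (1 / (4 * T))) : Set L2) := by
    rw [← Submodule.topologicalClosure_coe]
    exact radialSubmodule_le _ hf
  rw [← (Submodule.isClosed_topologicalClosure (controlTerms hT.le P)).closure_eq]
  refine map_mem_closure Φ.continuous hcl fun g hg => ?_
  -- As `Φ` is only real linear, induction over the complex span needs the claim for all complex
  -- multiples of `g`.
  suffices h : ∀ c : ℂ, Φ (c • g) ∈ (controlTerms hT.le P).topologicalClosure by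
    have := h 1
    rwa [one_smul] at this
  induction (show g ∈ Submodule.span ℂ (gaussians (1 / (4 * T))) from hg)
    using Submodule.span_induction with
  | mem x hx =>
    obtain ⟨p, hp, hpT, rfl⟩ := hx
    intro c
    obtain ⟨d, hd, hde⟩ := hΦ c p hp
    rw [hde, ← SetLike.mem_coe, Submodule.topologicalClosure_coe]
    exact smul_gaussian_mem_closure hT hd hp hpT
  | zero => simp
  | add x y hx hy ihx ihy =>
    intro c
    rw [smul_add, map_add]
    exact Submodule.add_mem _ (ihx hx c) (ihy hy c)
  | smul z x hx ih =>
    intro c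
    rw [smul_smul]
    exact ih hx (c * z)

/-- The real part of an element of `L²(ℝ²)`. -/
def realPartL2 : L2 →L[ℝ] L2 := (Complex.ofRealCLM ∘L Complex.reCLM).compLpL 2 volume

theorem coeFn_realPartL2 (f : L2) : ∀ᵐ x, realPartL2 f x = ((f x).re : ℂ) :=
  ContinuousLinearMap.coeFn_compLpL _ f

theorem realPartL2_smul_gaussian (c : ℂ) {p : ℝ} (hp : 0 < p) :
    realPartL2 (c • gaussian p hp) = (c.re : ℂ) • gaussian p hp := by
  refine Lp.ext ?_
  filter_upwards [coeFn_realPartL2 (c • gaussian p hp), Lp.coeFn_smul c (gaussian p hp),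
    Lp.coeFn_smul (c.re : ℂ) (gaussian p hp), (memLp_gaussian hp).coeFn_toLp] with x h1 h2 h3 h4
  rw [h1, h2, h3, Pi.smul_apply, Pi.smul_apply, gaussian, h4, smul_eq_mul, smul_eq_mul,
    Complex.re_mul_ofReal, Complex.ofReal_mul]

theorem realPartL2_eq_self {f : L2} (hf : ∀ᵐ x, (f x).im = 0) : realPartL2 f = f := by
  refine Lp.ext ?_
  filter_upwards [coeFn_realPartL2 f, hf] with x h1 h2
  rw [h1]
  exact Complex.ext rfl h2.symm

theorem im_freeHeat (T : ℝ) {W₀ : EvenL2} (h : IsRealValued W₀) (x : Plane) :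
    (freeHeat T W₀ x).im = 0 := by
  have e : freeHeat T W₀ x =
      ((∫ y, heatKernel T (x - y) * ((W₀ : L2) y).re : ℝ) : ℂ) := by
    rw [freeHeat, convolution_eq_swap, ← integral_complex_ofReal]
    refine integral_congr_ae ?_
    filter_upwards [h] with y hy
    rw [ContinuousLinearMap.lsmul_apply, Complex.real_smul, Complex.ofReal_mul]
    congr 1
    exact Complex.ext rfl hy
  rw [e, Complex.ofReal_im]

end HeatControl

end

/-! ### The criterion for approximate controllability -/

theorem theorem3p13 (T : ℝ) (hT : 0 < T) (W₀ Wend : HeatControl.EvenL2) :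
    (HeatControl.ApproxControllable (HeatControl.controls T) T W₀ Wend ↔
      HeatControl.MemRadial (fun x : HeatControl.Plane =>
        (Wend : HeatControl.L2) x - HeatControl.freeHeat T W₀ x)) ∧
    (HeatControl.IsRealValued W₀ → HeatControl.IsRealValued Wend →
      (HeatControl.ApproxControllable (HeatControl.realControls T) T W₀ Wend ↔
        HeatControl.MemRadial (fun x : HeatControl.Plane =>
          (Wend : HeatControl.L2) x - HeatControl.freeHeat T W₀ x))) := by
  open HeatControl MeasureTheory Set Filter in
  have hfree : freeHeat T W₀ =ᵐ[volume] (freeState hT.le W₀ : L2) := freeHeat_ae_eq hT W₀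
  have hae : (fun x : Plane => (Wend : L2) x - freeHeat T W₀ x) =ᵐ[volume]
      ((Wend : L2) - freeState hT.le W₀ : L2) := by
    filter_upwards [hfree, Lp.coeFn_sub (Wend : L2) (freeState hT.le W₀)] with x h1 h2
    rw [h1, h2, Pi.sub_apply]
  rw [memRadial_iff hae]
  have hrad (P : Submodule ℝ ℂ) :
      closure (controlTerms hT.le P : Set L2) ⊆ radialSubmodule :=
    closure_minimal (controlTerms_subset_radialSubmodule hT.le P) isClosed_radialSubmodule
  refine ⟨?_, fun h0 h1 => ?_⟩
  · rw [approxControllable_iff hT (controlClass_controls T)]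
    exact ⟨fun h => hrad _ h, fun h => map_radial_mem_closure hT (P := ⊤)
      (ContinuousLinearMap.id ℝ L2) (fun c p hp => ⟨c, Submodule.mem_top, rfl⟩) h⟩
  · rw [approxControllable_iff hT (controlClass_realControls T)]
    refine ⟨fun h => hrad _ h, fun h => ?_⟩
    have := map_radial_mem_closure hT (P := realLine) realPartL2
      (fun c p hp => ⟨_, ofReal_mem_realLine _, realPartL2_smul_gaussian c hp⟩) h
    -- The target is its own real part, because the heat kernel keeps the free evolution of real
    -- data real.
    rwa [realPartL2_eq_self] at this
    filter_upwards [hae, h1] with x hx hx1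
    rw [← hx, Complex.sub_im, im_freeHeat T h0, hx1, sub_zero]
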